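/- Work in the language of second-order arithmetic, over $\mathsf{RCA}_0$ (basic axioms, $\Sigma^0_1$ induction, $\Delta^0_1$ comprehension). A *labeled Borel code* is a nonempty well-founded tree $T\subseteq\omega^{<\omega}$ with a labeling function $\ell$ on $T$ such that every interior node is labeled $\cup$ or $\cap$ and every leaf is labeled by a standard code of a clopen subset of $2^\omega$ (the three kinds of labels being distinguishable). For $X\in 2^\omega$, an *evaluation map* for $X$ in $T$ is a function $f:T\to\{0,1\}$ such that: if $\sigma$ is a leaf, $f(\sigma)=1$ iff $X$ is in the clopen set coded by $\ell(\sigma)$; if $\ell(\sigma)=\cup$, $f(\sigma)=1$ iff $f(\sigma^\smallfrown n)=1$ for some $n$ with $\sigma^\smallfrown n\in T$; if $\ell(\sigma)=\cap$, $f(\sigma)=1$ iff $f(\sigma^\smallfrown n)=1$ for all $n$ with $\sigma^\smallfrown n\in T$. The code $T$ is *completely determined* if every $X\in 2^\omega$ has an evaluation map in $T$. A *formula of $L_{\omega_1,\omega}$* (with no atomic formulas other than $\mathtt{true}$ and $\mathtt{false}$) is a nonempty well-founded tree whose interior nodes are labeled $\cup$ or $\cap$ and whose leaves are labeled $\mathtt{true}$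 or $\mathtt{false}$. An evaluation map for it is defined in the same way, with $f(\sigma)=1$ at leaves labeled $\mathtt{true}$ and $f(\sigma)=0$ at leaves labeled $\mathtt{false}$. The formula is *completely determined* if it has an evaluation map, and *true* if it has an evaluation map $f$ with $f(\lambda)=1$, where $\lambda$ is the empty string. **Proposition.** The following two statements are equivalent over $\mathsf{RCA}_0$, i.e. every model of $\mathsf{RCA}_0$ (with arbitrary, possibly nonstandard, first-order part) satisfies one if and only if it satisfies the other. 1. (A countable union of completely determined Borel sets is a completely determined Borel set.) For every sequence $(T^k)_{k\in\mathbb N}$ of completely determined labeled Borel codes, the code for their union, namely the tree $\{\lambda\}\cup\{\langle k\rangle^\smallfrown\sigma : k\in\mathbb N,\ \sigma\in T^k\}$ in which $\lambda$ is labeled $\cup$ and $\langle k\rangle^\smallfrown\sigma$ carries the label of $\sigma$ in $T^k$, is a completely determined labeled Borel code. 2. ($\mathsf{L}_{\omega_1,\omega}\text{-}\mathsf{CA}$.) For every sequence $(\phi_k)_{k\in\mathbb N}$ of completely determined formulas of $L_{\omega_1,\omega}$, the set $\{k:\phi_k\text{ is true}\}$ exists. -/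

import Mathlib

universe u

namespace SOA

/-! ## Structures for the language of second-order arithmetic -/

/-- A structure for the two-sorted language of second-order arithmetic (general, "Henkin"
semantics): a possibly nonstandard number part together with a nonempty collection of subsets of
it, over which the set variables range. -/
structure L2Structure where
  Num : Type u
  zero : Num
  one : Num
  add : Num → Num → Num
  mul : Num → Num → Num
  lt : Num → Num → Prop
  Sets : Set (Set Num)
  sets_nonempty : Sets.Nonempty

instance (M : L2Structure.{u}) : Zero M.Num := ⟨M.zero⟩
instance (M : L2Structure.{u}) : One M.Num := ⟨M.one⟩
instance (M : L2Structure.{u}) : Add M.Num := ⟨M.add⟩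
instance (M : L2Structure.{u}) : Mul M.Num := ⟨M.mul⟩
instance (M : L2Structure.{u}) : LT M.Num := ⟨M.lt⟩

/-! ## Bounded formulas and the axioms of `RCA₀` -/

/-- Numerical terms; number variables are de Bruijn indices. -/
inductive NumTerm : Type
  | var (i : ℕ) : NumTerm
  | zero : NumTerm
  | one : NumTerm
  | add (s t : NumTerm) : NumTerm
  | mul (s t : NumTerm) : NumTerm

/-- Bounded-quantifier formulas, with free number and set variables. `ball t φ` is `∀ x < t, φ`,
where `x` is variable `0` of `φ` (and the old variable `i` becomes variable `i + 1` of `φ`); the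
term `t` does not contain `x`. The other connectives and the bounded existential quantifier are
classically definable from those listed. -/
inductive BddFormula : Type
  | eq (s t : NumTerm) : BddFormula
  | lt (s t : NumTerm) : BddFormula
  | mem (t : NumTerm) (i : ℕ) : BddFormula
  | neg (φ : BddFormula) : BddFormula
  | conj (φ ψ : BddFormula) : BddFormula
  | ball (t : NumTerm) (φ : BddFormula) : BddFormula

/-- The valuation `v` with the value `a` put in front. -/
def push {α : Type u} (a : α) (v : ℕ → α) : ℕ → α
  | 0 => a
  | i + 1 => v i

namespace L2Structure

variable (M : L2Structure.{u})

/-- The value of a term under a valuation of the number variables. -/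
def termVal (v : ℕ → M.Num) : NumTerm → M.Num
  | .var i => v i
  | .zero => 0
  | .one => 1
  | .add s t => termVal v s + termVal v t
  | .mul s t => termVal v s * termVal v t

/-- Truth of a bounded formula under valuations `S` of the set variables and `v` of the number
variables. -/
def Sat (S : ℕ → Set M.Num) : (ℕ → M.Num) → BddFormula → Prop
  | v, .eq s t => M.termVal v s = M.termVal v t
  | v, .lt s t => M.termVal v s < M.termVal v t
  | v, .mem t i => M.termVal v t ∈ S i
  | v, .neg φ => ¬ Sat S v φ
  | v, .conj φ ψ => Sat S v φ ∧ Sat S v ψ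
  | v, .ball t φ => ∀ x : M.Num, x < M.termVal v t → Sat S (push x v) φ

/-- `M` is a model of `RCA₀`: the basic axioms, the induction scheme for `Σ⁰₁` formulas
`∃ m, φ(m, n)` and the comprehension scheme for `Δ⁰₁` formulas, where `φ`, `ψ` are bounded and
number and set parameters from `M` are allowed. -/
structure IsModelRCA0 : Prop where
  succ_ne_zero : ∀ n : M.Num, n + 1 ≠ 0
  succ_inj : ∀ m n : M.Num, m + 1 = n + 1 → m = n
  add_zero : ∀ m : M.Num, m + 0 = m
  add_succ : ∀ m n : M.Num, m + (n + 1) = (m + n) + 1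
  mul_zero : ∀ m : M.Num, m * 0 = 0
  mul_succ : ∀ m n : M.Num, m * (n + 1) = m * n + m
  not_lt_zero : ∀ m : M.Num, ¬ m < 0
  lt_succ : ∀ m n : M.Num, m < n + 1 ↔ (m < n ∨ m = n)
  sigma01_induction : ∀ (φ : BddFormula) (S : ℕ → Set M.Num) (v : ℕ → M.Num),
    (∀ i, S i ∈ M.Sets) →
    (∃ m, M.Sat S (push m (push 0 v)) φ) →
    (∀ n, (∃ m, M.Sat S (push m (push n v)) φ) → ∃ m, M.Sat S (push m (push (n + 1) v)) φ) →
    ∀ n, ∃ m, M.Sat S (push m (push n v)) φ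
  delta01_comprehension : ∀ (φ ψ : BddFormula) (S : ℕ → Set M.Num) (v : ℕ → M.Num),
    (∀ i, S i ∈ M.Sets) →
    (∀ n, (∃ m, M.Sat S (push m (push n v)) φ) ↔ ∀ m, M.Sat S (push m (push n v)) ψ) →
    ∃ X ∈ M.Sets, ∀ n, n ∈ X ↔ ∃ m, M.Sat S (push m (push n v)) φ

variable {M}

/-! ## Coding inside `M`

From here on every quantifier ranges over the numbers of `M` or over the members of `M.Sets`, so
that each notion is the interpretation in `M` of a formula of second-order arithmetic. -/

/-- The pairing function `(i, j) = (i + j)² + i`. -/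
def pair (i j : M.Num) : M.Num := (i + j) * (i + j) + i

/-- `i` belongs to the finite set `{i < k : m (i + 1) + 1 divides n}` represented by
`c = (k, (m, n))`. A number not of this form represents the empty set. -/
def FinMem (i c : M.Num) : Prop :=
  ∃ k m n : M.Num, c = pair k (pair m n) ∧ i < k ∧ ∃ d, n = (m * (i + 1) + 1) * d

/-- `c` is the code of a finite set: the least number representing that set. -/
def IsFinCode (c : M.Num) : Prop :=
  ∀ c', c' < c → ∃ i, ¬ (FinMem i c' ↔ FinMem i c)

/-- `σ` codes a finite sequence of length `l`, i.e. (the graph of) a function with domain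
`{i : i < l}`. -/
def SeqLen (σ l : M.Num) : Prop :=
  IsFinCode σ ∧ (∀ x, FinMem x σ → ∃ i a, i < l ∧ x = pair i a) ∧
    ∀ i, i < l → ∃! a, FinMem (pair i a) σ

/-- `σ` codes a finite sequence, an element of `ω^{<ω}`. -/
def IsSeq (σ : M.Num) : Prop := ∃ l, SeqLen σ l

/-- `σ(i) = a`, for a sequence `σ`. -/
def Entry (σ i a : M.Num) : Prop := FinMem (pair i a) σ

/-- The code `0 = (0, (0, 0))` of the empty set, i.e. of the empty sequence `λ`. -/
def nil : M.Num := 0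

/-- The sequence `σ` is an initial segment of the sequence `τ`. -/
def Prefix (σ τ : M.Num) : Prop :=
  ∃ l l', SeqLen σ l ∧ SeqLen τ l' ∧ (l < l' ∨ l = l') ∧
    ∀ i, i < l → ∀ a, Entry σ i a ↔ Entry τ i a

/-- `τ = σ⌢⟨n⟩`. -/
def Append (σ n τ : M.Num) : Prop :=
  ∃ l, SeqLen σ l ∧ SeqLen τ (l + 1) ∧
    (∀ i, i < l → ∀ a, Entry τ i a ↔ Entry σ i a) ∧ Entry τ l n

/-- `τ = ⟨k⟩⌢σ`. -/
def Prepend (k σ τ : M.Num) : Prop :=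
  ∃ l, SeqLen σ l ∧ SeqLen τ (l + 1) ∧ Entry τ 0 k ∧
    ∀ i, i < l → ∀ a, Entry τ (i + 1) a ↔ Entry σ i a

/-- `F` is (the graph of) a function with domain `D`. -/
def IsFunOn (F D : Set M.Num) : Prop :=
  (∀ x ∈ F, ∃ i ∈ D, ∃ a, x = pair i a) ∧ ∀ i ∈ D, ∃! a, pair i a ∈ F

/-- The `k`-th member of the sequence of sets coded by `Z`. -/
def sec (Z : Set M.Num) (k : M.Num) : Set M.Num := {n | pair k n ∈ Z}

/-- `c` codes a finite set of binary strings, i.e. it is a standard code for a clopen subset of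
`2^ω`. -/
def IsClopenCode (c : M.Num) : Prop :=
  IsFinCode c ∧ ∀ p, FinMem p c → IsSeq p ∧ ∀ i a, Entry p i a → a = 0 ∨ a = 1

/-- `X ∈ 2^ω` (given as a set) belongs to the clopen set coded by `c`: some string in the coded
finite set is an initial segment of `X`. -/
def InClopen (X : Set M.Num) (c : M.Num) : Prop :=
  ∃ p, FinMem p c ∧ ∀ i, (Entry p i 1 → i ∈ X) ∧ (Entry p i 0 → i ∉ X)

/-! ## Labeled trees, Borel codes and formulas -/

/-- `T ⊆ ω^{<ω}` is a (nonempty) tree. -/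
def IsTree (T : Set M.Num) : Prop :=
  nil ∈ T ∧ (∀ σ ∈ T, IsSeq σ) ∧ ∀ σ τ, Prefix σ τ → τ ∈ T → σ ∈ T

/-- The function (with graph) `G : ω → ω` is an infinite path through `T`. -/
def IsPath (T G : Set M.Num) : Prop :=
  IsFunOn G Set.univ ∧
    ∀ n, ∃ σ ∈ T, SeqLen σ n ∧ ∀ i, i < n → ∀ a, Entry σ i a → pair i a ∈ G

/-- `T` is well-founded in the sense of `M`: no member of `M.Sets` is a path. -/
def IsWF (T : Set M.Num) : Prop := ∀ G ∈ M.Sets, ¬ IsPath T G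

/-- `τ` is an immediate successor of `σ` in `T`. -/
def Child (T : Set M.Num) (σ τ : M.Num) : Prop := τ ∈ T ∧ ∃ n, Append σ n τ

/-- `(T, L)` is a well-founded tree with a labeling function `L` on `T`, such that interior nodes
are labeled `∪` or `∩` and leaves are labeled by some `c` with `leafOK c`. The labels `∪`, `∩` and
`c` are represented by the numbers `0`, `1` and `c + 2`, respectively. -/
def IsLabeledTree (leafOK : M.Num → Prop) (T L : Set M.Num) : Prop :=
  IsTree T ∧ IsWF T ∧ IsFunOn L T ∧
    ∀ σ ∈ T,
      ((∃ τ, Child T σ τ) → pair σ 0 ∈ L ∨ pair σ 1 ∈ L) ∧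
      ((¬ ∃ τ, Child T σ τ) → ∃ c, leafOK c ∧ pair σ (c + 1 + 1) ∈ L)

/-- `F : T → {0, 1}` is an evaluation map for `(T, L)`, where a leaf labeled by `c` gets the
value `1` exactly if `leafTrue c`. -/
def IsEval (leafTrue : M.Num → Prop) (T L F : Set M.Num) : Prop :=
  IsFunOn F T ∧ (∀ σ ∈ T, pair σ 0 ∈ F ∨ pair σ 1 ∈ F) ∧
    ∀ σ ∈ T,
      (∀ c, pair σ (c + 1 + 1) ∈ L → (pair σ 1 ∈ F ↔ leafTrue c)) ∧
      (pair σ 0 ∈ L → (pair σ 1 ∈ F ↔ ∃ τ, Child T σ τ ∧ pair τ 1 ∈ F)) ∧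
      (pair σ 1 ∈ L → (pair σ 1 ∈ F ↔ ∀ τ, Child T σ τ → pair τ 1 ∈ F))

/-- `(T, L)` is a labeled Borel code. -/
def IsBorelCode (T L : Set M.Num) : Prop := IsLabeledTree IsClopenCode T L

/-- `(T, L)` is a completely determined Borel code: every `X ∈ 2^ω` has an evaluation map. -/
def IsCDBorelCode (T L : Set M.Num) : Prop :=
  IsBorelCode T L ∧ ∀ X ∈ M.Sets, ∃ F ∈ M.Sets, IsEval (InClopen X) T L F

/-- `(T, L)` is a formula of `L_{ω₁,ω}` whose only atomic formulas are `false` (the leaf label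
with `c = 0`) and `true` (the leaf label with `c = 1`). -/
def IsFormula (T L : Set M.Num) : Prop := IsLabeledTree (fun c => c = 0 ∨ c = 1) T L

/-- `F` is an evaluation map for the formula `(T, L)`. -/
def IsFormulaEval (T L F : Set M.Num) : Prop := IsEval (fun c => c = 1) T L F

/-- `(T, L)` is a completely determined formula: it has an evaluation map. -/
def IsCDFormula (T L : Set M.Num) : Prop := IsFormula T L ∧ ∃ F ∈ M.Sets, IsFormulaEval T L F

/-- The formula `(T, L)` is true: some evaluation map gives its root the value `1`. -/
def IsTrueFormula (T L : Set M.Num) : Prop :=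
  ∃ F ∈ M.Sets, IsFormulaEval T L F ∧ pair nil 1 ∈ F

/-- The tree `{λ} ∪ {⟨k⟩⌢σ : σ ∈ T^k}`, where `T^k` is the `k`-th member of the sequence `TT`. -/
def unionTree (TT : Set M.Num) : Set M.Num :=
  {τ | τ = nil ∨ ∃ k σ, σ ∈ sec TT k ∧ Prepend k σ τ}

/-- The labeling of the union tree: `λ` is labeled `∪`, and `⟨k⟩⌢σ` has the label which `σ` has in
the `k`-th code. -/
def unionLabel (LL : Set M.Num) : Set M.Num :=
  {x | x = pair nil 0 ∨ ∃ k σ τ c, pair σ c ∈ sec LL k ∧ Prepend k σ τ ∧ x = pair τ c}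

variable (M)

/-- "A countable union of completely determined Borel sets is a completely determined Borel set",
in `M`: for every sequence of completely determined Borel codes, the code for its union exists and
is a completely determined Borel code. -/
def CountableUnionCD : Prop :=
  ∀ TT ∈ M.Sets, ∀ LL ∈ M.Sets, (∀ k : M.Num, IsCDBorelCode (sec TT k) (sec LL k)) →
    unionTree TT ∈ M.Sets ∧ unionLabel LL ∈ M.Sets ∧
      IsCDBorelCode (unionTree TT) (unionLabel LL)

/-- The principle `L_{ω₁,ω}-CA` in `M`: for every sequence of completely determined formulas, the
set of indices of the true ones exists. -/
def LomegaCA : Prop :=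
  ∀ TT ∈ M.Sets, ∀ LL ∈ M.Sets, (∀ k : M.Num, IsCDFormula (sec TT k) (sec LL k)) →
    ∃ X ∈ M.Sets, ∀ k : M.Num, k ∈ X ↔ IsTrueFormula (sec TT k) (sec LL k)

end L2Structure

end SOA

/-!
Both directions rest on the fact that a well-founded labeled tree has at most one value at its root:
if two evaluation maps disagree at a node, they disagree at one of its children, so a disagreement
at the root yields a path, which is built by primitive recursion (`exists_path`,
`IsEval.root_iff`).

*From unions to comprehension* (`CountableUnionCD.lomegaCA`). A formula becomes a Borel code when
its leaf labels `true` and `false` are read as the clopen sets `2^ω` and `∅`. An evaluation map of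
the formula is then an evaluation map of the code for every `X`, so the codes are completely
determined. An evaluation map of their union at an arbitrary `X` contains, uniformly in `k`, an
evaluation map of the `k`-th formula, and its values at the nodes `⟨k⟩` tell which formulas are true.

*From comprehension to unions* (`LomegaCA.countableUnionCD`). Each code `T^k` of the sequence has an
evaluation map for `X`, but these maps are not given uniformly in `k`. For each node `σ` of each
`T^k`, a formula `φ_{k,σ}` says that `X` belongs to the set coded at `σ` (`IsNodeFormula`). It is
completely determined, and by uniqueness of the root value it is true exactly if an evaluation map
of `T^k` takes the value `1` at `σ`. The set of the true `φ_{k,σ}` thus computes evaluation maps of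
all `T^k` simultaneously, and with the value at the root added, an evaluation map of the union.

The larger part of the text develops arithmetic and computability inside a model of `RCA₀`. Its
number part is made an ordered commutative semiring. Definability is treated semantically: `S1`,
`D1` and `Comp` say that a relation is `Σ⁰₁`, that it is `Δ⁰₁`, and that a function has a `Σ⁰₁`
graph, always with parameters; they are classes with closure properties as instances. The codes of
finite sets exist by a version of the Chinese remainder theorem (`D1.exists_finCode`).
-/

namespace SOA.L2Structure

variable {M : L2Structure.{u}}

/-! ### Relations defined by bounded formulas -/

/-- Polynomial functions `Numᵏ → Num` with parameters: the functions defined by terms. -/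
inductive Poly : {k : ℕ} → ((Fin k → M.Num) → M.Num) → Prop
  | var {k : ℕ} (i : Fin k) : Poly (fun x => x i)
  | const {k : ℕ} (a : M.Num) : Poly (fun _ : Fin k → M.Num => a)
  | add {k : ℕ} {f g : (Fin k → M.Num) → M.Num} :
      Poly f → Poly g → Poly (fun x => f x + g x)
  | mul {k : ℕ} {f g : (Fin k → M.Num) → M.Num} :
      Poly f → Poly g → Poly (fun x => f x * g x)

/-- The `k`-ary relations defined by bounded formulas with number and set parameters from `M`,
presented semantically, so that no formula and no list of parameters has to be named. -/
inductive Bdd : {k : ℕ} → ((Fin k → M.Num) → Prop) → Prop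
  | eq {k : ℕ} {f g : (Fin k → M.Num) → M.Num} : Poly f → Poly g → Bdd (fun x => f x = g x)
  | lt {k : ℕ} {f g : (Fin k → M.Num) → M.Num} : Poly f → Poly g → Bdd (fun x => f x < g x)
  | mem {k : ℕ} {f : (Fin k → M.Num) → M.Num} {X : Set M.Num} :
      Poly f → X ∈ M.Sets → Bdd (fun x => f x ∈ X)
  | neg {k : ℕ} {P : (Fin k → M.Num) → Prop} : Bdd P → Bdd (fun x => ¬ P x)
  | conj {k : ℕ} {P Q : (Fin k → M.Num) → Prop} : Bdd P → Bdd Q → Bdd (fun x => P x ∧ Q x)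
  | ball {k : ℕ} {f : (Fin k → M.Num) → M.Num} {P : (Fin k → M.Num) → M.Num → Prop} :
      Poly f → Bdd (fun z : Fin (k + 1) → M.Num => P (fun i => z i.succ) (z 0)) →
      Bdd (fun x => ∀ y, y < f x → P x y)

theorem Poly.subst {k : ℕ} {f : (Fin k → M.Num) → M.Num} (hf : Poly f) {m : ℕ}
    {r : Fin k → (Fin m → M.Num) → M.Num} (hr : ∀ i, Poly (r i)) :
    Poly (fun z : Fin m → M.Num => f (fun i => r i z)) := by
  induction hf with
  | var i => exact hr i
  | const a => exact .const a
  | add _ _ h₁ h₂ => exact .add h₁ h₂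
  | mul _ _ h₁ h₂ => exact .mul h₁ h₂

theorem Bdd.subst {k : ℕ} {P : (Fin k → M.Num) → Prop} (hP : Bdd P) :
    ∀ {m : ℕ} {r : Fin k → (Fin m → M.Num) → M.Num}, (∀ i, Poly (r i)) →
      Bdd (fun z : Fin m → M.Num => P (fun i => r i z)) := by
  induction hP with
  | eq hf hg => intro m r hr; exact .eq (hf.subst hr) (hg.subst hr)
  | lt hf hg => intro m r hr; exact .lt (hf.subst hr) (hg.subst hr)
  | mem hf hX => intro m r hr; exact .mem (hf.subst hr) hX
  | neg _ h => intro m r hr; exact .neg (h hr)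
  | conj _ _ h₁ h₂ => intro m r hr; exact .conj (h₁ hr) (h₂ hr)
  | @ball k f P hf _ h =>
    intro m r hr
    refine .ball (P := fun z y => P (fun i => r i z) y) (hf.subst hr) ?_
    exact h (r := Fin.cases (fun z => z 0) fun i z => r i (fun j => z j.succ))
      (Fin.cases (.var 0) fun i => (hr i).subst fun j => .var j.succ)

theorem Bdd.reindex {k : ℕ} {P : (Fin k → M.Num) → Prop} (hP : Bdd P) {m : ℕ}
    (r : Fin k → Fin m) : Bdd (fun z : Fin m → M.Num => P (fun i => z (r i))) :=
  hP.subst fun i => .var (r i)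

theorem Bdd.subst_cons {k m : ℕ} {P : (Fin (k + 1) → M.Num) → Prop} (hP : Bdd P)
    {f : (Fin m → M.Num) → M.Num} (hf : Poly f) {r : Fin k → (Fin m → M.Num) → M.Num}
    (hr : ∀ i, Poly (r i)) :
    Bdd (fun z : Fin m → M.Num => P (Fin.cons (f z) fun i => r i z)) := by
  have := hP.subst (r := Fin.cases f r) (Fin.cases hf hr)
  convert this using 3
  funext i
  cases i using Fin.cases <;> rfl

theorem Bdd.subst_cons₂ {k m : ℕ} {P : (Fin (k + 2) → M.Num) → Prop} (hP : Bdd P)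
    {f g : (Fin m → M.Num) → M.Num} (hf : Poly f) (hg : Poly g)
    {r : Fin k → (Fin m → M.Num) → M.Num} (hr : ∀ i, Poly (r i)) :
    Bdd (fun z : Fin m → M.Num => P (Fin.cons (f z) (Fin.cons (g z) fun i => r i z))) := by
  have := hP.subst_cons hf (r := Fin.cases g r) (Fin.cases hg hr)
  convert this using 4
  funext i
  cases i using Fin.cases <;> rfl

theorem Bdd.congr {k : ℕ} {P Q : (Fin k → M.Num) → Prop} (hP : Bdd P) (h : ∀ x, Q x ↔ P x) :
    Bdd Q := by
  have : Q = P := funext fun x => propext (h x)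
  rwa [this]

theorem Bdd.or {k : ℕ} {P Q : (Fin k → M.Num) → Prop} (hP : Bdd P) (hQ : Bdd Q) :
    Bdd (fun x => P x ∨ Q x) :=
  (Bdd.neg (.conj (.neg hP) (.neg hQ))).congr fun x => by tauto

theorem Bdd.bex {k : ℕ} {f : (Fin k → M.Num) → M.Num} {P : (Fin k → M.Num) → M.Num → Prop}
    (hf : Poly f) (hP : Bdd (fun z : Fin (k + 1) → M.Num => P (fun i => z i.succ) (z 0))) :
    Bdd (fun x => ∃ y, y < f x ∧ P x y) :=
  (Bdd.neg (.ball (P := fun x y => ¬ P x y) hf (.neg hP))).congr fun x => by push Not; rfl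

/-- The valuation that starts with the tuple `x` and goes on with `v`. -/
def extend {k : ℕ} (x : Fin k → M.Num) (v : ℕ → M.Num) : ℕ → M.Num :=
  fun i => if h : i < k then x ⟨i, h⟩ else v (i - k)

theorem push_extend {k : ℕ} (y : M.Num) (x : Fin k → M.Num) (v : ℕ → M.Num) :
    push y (extend x v) = extend (Fin.cons y x : Fin (k + 1) → M.Num) v := by
  funext i
  cases i with
  | zero => simp [push, extend]
  | succ i =>
    by_cases h : i < k
    · simp only [push, extend, h, Nat.add_lt_add_iff_right, dite_true]
      exact (Fin.cons_succ (α := fun _ => M.Num) y x ⟨i, h⟩).symm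
    · simp [push, extend, h]

/-- A polynomial function is the value of a term as soon as its parameters are listed by the
valuation. Stating this for all valuations that list the parameters makes it unnecessary to rename
variables when two terms are combined. -/
theorem Poly.realize {k : ℕ} {f : (Fin k → M.Num) → M.Num} (hf : Poly f) :
    ∃ A : Set M.Num, A.Countable ∧ ∀ v : ℕ → M.Num, A ⊆ Set.range v →
      ∃ t, ∀ x, M.termVal (extend x v) t = f x := by
  induction hf with
  | var i =>
    exact ⟨∅, Set.countable_empty, fun v _ => ⟨.var i, fun x => by simp [termVal, extend]⟩⟩
  | @const a =>
    refine ⟨{a}, Set.countable_singleton a, fun v hv => ?_⟩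
    obtain ⟨j, hj⟩ := hv rfl
    exact ⟨.var (k + j), fun x => by simp [termVal, extend, hj]⟩
  | add _ _ h₁ h₂ =>
    obtain ⟨A, hA, h₁⟩ := h₁
    obtain ⟨B, hB, h₂⟩ := h₂
    refine ⟨A ∪ B, hA.union hB, fun v hv => ?_⟩
    obtain ⟨s, hs⟩ := h₁ v (Set.subset_union_left.trans hv)
    obtain ⟨t, ht⟩ := h₂ v (Set.subset_union_right.trans hv)
    exact ⟨.add s t, fun x => by simp [termVal, hs, ht]⟩
  | mul _ _ h₁ h₂ =>
    obtain ⟨A, hA, h₁⟩ := h₁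
    obtain ⟨B, hB, h₂⟩ := h₂
    refine ⟨A ∪ B, hA.union hB, fun v hv => ?_⟩
    obtain ⟨s, hs⟩ := h₁ v (Set.subset_union_left.trans hv)
    obtain ⟨t, ht⟩ := h₂ v (Set.subset_union_right.trans hv)
    exact ⟨.mul s t, fun x => by simp [termVal, hs, ht]⟩

/-- The analogue of `Poly.realize` for bounded relations, with set parameters in addition. The
parameters form countable sets, since these can be listed by one valuation. -/
theorem Bdd.realize {k : ℕ} {P : (Fin k → M.Num) → Prop} (hP : Bdd P) :
    ∃ A : Set M.Num, A.Countable ∧ ∃ 𝒳 ⊆ M.Sets, 𝒳.Countable ∧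
      ∀ (v : ℕ → M.Num) (S : ℕ → Set M.Num), A ⊆ Set.range v → 𝒳 ⊆ Set.range S →
        ∃ φ, ∀ x, M.Sat S (extend x v) φ ↔ P x := by
  induction hP with
  | eq hf hg =>
    obtain ⟨A, hA, h₁⟩ := hf.realize
    obtain ⟨B, hB, h₂⟩ := hg.realize
    refine ⟨A ∪ B, hA.union hB, ∅, Set.empty_subset _, Set.countable_empty, fun v S hv _ => ?_⟩
    obtain ⟨s, hs⟩ := h₁ v (Set.subset_union_left.trans hv)
    obtain ⟨t, ht⟩ := h₂ v (Set.subset_union_right.trans hv)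
    exact ⟨.eq s t, fun x => by simp [Sat, hs, ht]⟩
  | lt hf hg =>
    obtain ⟨A, hA, h₁⟩ := hf.realize
    obtain ⟨B, hB, h₂⟩ := hg.realize
    refine ⟨A ∪ B, hA.union hB, ∅, Set.empty_subset _, Set.countable_empty, fun v S hv _ => ?_⟩
    obtain ⟨s, hs⟩ := h₁ v (Set.subset_union_left.trans hv)
    obtain ⟨t, ht⟩ := h₂ v (Set.subset_union_right.trans hv)
    exact ⟨.lt s t, fun x => by simp [Sat, hs, ht]⟩
  | @mem k f X hf hX =>
    obtain ⟨A, hA, h₁⟩ := hf.realize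
    refine ⟨A, hA, {X}, Set.singleton_subset_iff.2 hX, Set.countable_singleton X,
      fun v S hv hS => ?_⟩
    obtain ⟨s, hs⟩ := h₁ v hv
    obtain ⟨j, hj⟩ := hS rfl
    exact ⟨.mem s j, fun x => by simp [Sat, hs, hj]⟩
  | neg _ h =>
    obtain ⟨A, hA, 𝒳, h𝒳, h𝒳c, h⟩ := h
    refine ⟨A, hA, 𝒳, h𝒳, h𝒳c, fun v S hv hS => ?_⟩
    obtain ⟨φ, hφ⟩ := h v S hv hS
    exact ⟨.neg φ, fun x => by simp [Sat, hφ]⟩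
  | conj _ _ h₁ h₂ =>
    obtain ⟨A, hA, 𝒳, h𝒳, h𝒳c, h₁⟩ := h₁
    obtain ⟨B, hB, 𝒴, h𝒴, h𝒴c, h₂⟩ := h₂
    refine ⟨A ∪ B, hA.union hB, 𝒳 ∪ 𝒴, Set.union_subset h𝒳 h𝒴, h𝒳c.union h𝒴c,
      fun v S hv hS => ?_⟩
    obtain ⟨φ, hφ⟩ := h₁ v S (Set.subset_union_left.trans hv) (Set.subset_union_left.trans hS)
    obtain ⟨ψ, hψ⟩ := h₂ v S (Set.subset_union_right.trans hv) (Set.subset_union_right.trans hS)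
    exact ⟨.conj φ ψ, fun x => by simp [Sat, hφ, hψ]⟩
  | ball hf _ h =>
    obtain ⟨A, hA, h₁⟩ := hf.realize
    obtain ⟨B, hB, 𝒳, h𝒳, h𝒳c, h₂⟩ := h
    refine ⟨A ∪ B, hA.union hB, 𝒳, h𝒳, h𝒳c, fun v S hv hS => ?_⟩
    obtain ⟨t, ht⟩ := h₁ v (Set.subset_union_left.trans hv)
    obtain ⟨φ, hφ⟩ := h₂ v S (Set.subset_union_right.trans hv) hS
    exact ⟨.ball t φ, fun x => by simp [Sat, ht, push_extend, hφ]⟩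

/-- A bounded relation is defined by a bounded formula with parameters from `M`. -/
theorem Bdd.exists_formula {k : ℕ} {P : (Fin k → M.Num) → Prop} (hP : Bdd P) :
    ∃ (φ : BddFormula) (S : ℕ → Set M.Num) (v : ℕ → M.Num), (∀ i, S i ∈ M.Sets) ∧
      ∀ x, M.Sat S (extend x v) φ ↔ P x := by
  obtain ⟨A, hA, 𝒳, h𝒳, h𝒳c, h⟩ := hP.realize
  obtain ⟨X₀, hX₀⟩ := M.sets_nonempty
  obtain ⟨v, hv⟩ := (hA.insert 0).exists_eq_range (Set.insert_nonempty 0 A)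
  obtain ⟨S, hS⟩ := (h𝒳c.insert X₀).exists_eq_range (Set.insert_nonempty X₀ 𝒳)
  obtain ⟨φ, hφ⟩ := h v S (hv ▸ Set.subset_insert _ _) (hS ▸ Set.subset_insert _ _)
  refine ⟨φ, S, v, fun i => ?_, hφ⟩
  have : S i ∈ insert X₀ 𝒳 := hS ▸ Set.mem_range_self i
  rcases this with h | h
  · exact h ▸ hX₀
  · exact h𝒳 h

/-- Two bounded relations are defined by formulas with common parameters. -/
theorem Bdd.exists_formula₂ {k : ℕ} {P Q : (Fin k → M.Num) → Prop} (hP : Bdd P) (hQ : Bdd Q) :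
    ∃ (φ ψ : BddFormula) (S : ℕ → Set M.Num) (v : ℕ → M.Num), (∀ i, S i ∈ M.Sets) ∧
      (∀ x, M.Sat S (extend x v) φ ↔ P x) ∧ ∀ x, M.Sat S (extend x v) ψ ↔ Q x := by
  obtain ⟨A, hA, 𝒳, h𝒳, h𝒳c, h⟩ := hP.realize
  obtain ⟨B, hB, 𝒴, h𝒴, h𝒴c, h'⟩ := hQ.realize
  obtain ⟨X₀, hX₀⟩ := M.sets_nonempty
  obtain ⟨v, hv⟩ := ((hA.union hB).insert 0).exists_eq_range (Set.insert_nonempty 0 _)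
  obtain ⟨S, hS⟩ := ((h𝒳c.union h𝒴c).insert X₀).exists_eq_range (Set.insert_nonempty X₀ _)
  have hv' : A ∪ B ⊆ Set.range v := hv ▸ Set.subset_insert _ _
  have hS' : 𝒳 ∪ 𝒴 ⊆ Set.range S := hS ▸ Set.subset_insert _ _
  obtain ⟨φ, hφ⟩ := h v S (Set.subset_union_left.trans hv') (Set.subset_union_left.trans hS')
  obtain ⟨ψ, hψ⟩ := h' v S (Set.subset_union_right.trans hv') (Set.subset_union_right.trans hS')
  refine ⟨φ, ψ, S, v, fun i => ?_, hφ, hψ⟩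
  have : S i ∈ insert X₀ (𝒳 ∪ 𝒴) := hS ▸ Set.mem_range_self i
  rcases this with h | h | h
  · exact h ▸ hX₀
  · exact h𝒳 h
  · exact h𝒴 h

theorem push_push_eq_extend (m n : M.Num) (v : ℕ → M.Num) :
    push m (push n v) = extend ![m, n] v := by
  have : v = extend ![] v := by funext i; simp [extend]
  conv_lhs => rw [this, push_extend, push_extend]
  rfl

/-- The scheme of `Σ⁰₁` induction, for relations instead of formulas. -/
theorem sigma_induction [hM : Fact M.IsModelRCA0] {P : M.Num → M.Num → Prop}
    (hP : Bdd (fun x : Fin 2 → M.Num => P (x 0) (x 1))) (h₀ : ∃ m, P m 0)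
    (h₁ : ∀ n, (∃ m, P m n) → ∃ m, P m (n + 1)) (n : M.Num) : ∃ m, P m n := by
  obtain ⟨φ, S, v, hS, hφ⟩ := hP.exists_formula
  have key := hM.out.sigma01_induction φ S v hS
  simp only [push_push_eq_extend, hφ] at key
  exact key h₀ h₁ n

theorem bdd_induction [Fact M.IsModelRCA0] {P : M.Num → Prop}
    (hP : Bdd (fun x : Fin 1 → M.Num => P (x 0))) (h₀ : P 0)
    (h₁ : ∀ n, P n → P (n + 1)) (n : M.Num) : P n := by
  have key := sigma_induction (P := fun _ n => P n) (hP.reindex (fun _ => (1 : Fin 2))) ⟨0, h₀⟩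
    (fun n ⟨_, h⟩ => ⟨0, h₁ n h⟩) n
  exact key.elim fun _ h => h

/-- The scheme of `Δ⁰₁` comprehension, for relations instead of formulas. -/
theorem delta_comprehension [hM : Fact M.IsModelRCA0] {P Q : M.Num → M.Num → Prop}
    (hP : Bdd (fun x : Fin 2 → M.Num => P (x 0) (x 1)))
    (hQ : Bdd (fun x : Fin 2 → M.Num => Q (x 0) (x 1)))
    (h : ∀ n, (∃ m, P m n) ↔ ∀ m, Q m n) : ∃ X ∈ M.Sets, ∀ n, n ∈ X ↔ ∃ m, P m n := by
  obtain ⟨φ, ψ, S, v, hS, hφ, hψ⟩ := hP.exists_formula₂ hQ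
  have key := hM.out.delta01_comprehension φ ψ S v hS
  simp only [push_push_eq_extend, hφ, hψ] at key
  exact key h

variable [hM : Fact M.IsModelRCA0]

/-! ### Arithmetic in a model -/

theorem num_zero_add (a : M.Num) : 0 + a = a :=
  bdd_induction (P := fun a : M.Num => 0 + a = a) (.eq (.add (.const 0) (.var 0)) (.var 0))
    (hM.out.add_zero 0) (fun n h => by rw [hM.out.add_succ, h]) a

theorem num_succ_add (a b : M.Num) : a + 1 + b = a + b + 1 :=
  bdd_induction (P := fun b : M.Num => a + 1 + b = a + b + 1)
    (.eq (.add (.const (a + 1)) (.var 0)) (.add (.add (.const a) (.var 0)) (.const 1)))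
    (by rw [hM.out.add_zero, hM.out.add_zero])
    (fun n h => by rw [hM.out.add_succ, h, hM.out.add_succ]) b

theorem num_add_comm (a b : M.Num) : a + b = b + a :=
  bdd_induction (P := fun b : M.Num => a + b = b + a)
    (.eq (.add (.const a) (.var 0)) (.add (.var 0) (.const a)))
    (by rw [hM.out.add_zero, num_zero_add])
    (fun n h => by rw [hM.out.add_succ, h, num_succ_add]) b

theorem num_add_assoc (a b c : M.Num) : a + b + c = a + (b + c) :=
  bdd_induction (P := fun c : M.Num => a + b + c = a + (b + c))
    (.eq (.add (.const (a + b)) (.var 0)) (.add (.const a) (.add (.const b) (.var 0))))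
    (by rw [hM.out.add_zero, hM.out.add_zero])
    (fun n h => by rw [hM.out.add_succ, h, hM.out.add_succ, hM.out.add_succ]) c

theorem num_zero_mul (a : M.Num) : 0 * a = 0 :=
  bdd_induction (P := fun a : M.Num => 0 * a = 0) (.eq (.mul (.const 0) (.var 0)) (.const 0))
    (hM.out.mul_zero 0) (fun n h => by rw [hM.out.mul_succ, h, hM.out.add_zero]) a

theorem num_succ_mul (a b : M.Num) : (a + 1) * b = a * b + b :=
  bdd_induction (P := fun b : M.Num => (a + 1) * b = a * b + b)
    (.eq (.mul (.const (a + 1)) (.var 0)) (.add (.mul (.const a) (.var 0)) (.var 0)))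
    (by rw [hM.out.mul_zero, hM.out.mul_zero, hM.out.add_zero])
    (fun n h => by
      rw [hM.out.mul_succ, h, hM.out.mul_succ, num_add_assoc, num_add_assoc, ← num_add_assoc n a,
        num_add_comm n a, num_add_assoc]) b

theorem num_mul_comm (a b : M.Num) : a * b = b * a :=
  bdd_induction (P := fun b : M.Num => a * b = b * a)
    (.eq (.mul (.const a) (.var 0)) (.mul (.var 0) (.const a)))
    (by rw [hM.out.mul_zero, num_zero_mul])
    (fun n h => by rw [hM.out.mul_succ, h, num_succ_mul]) b

theorem num_mul_add (a b c : M.Num) : a * (b + c) = a * b + a * c :=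
  bdd_induction (P := fun c : M.Num => a * (b + c) = a * b + a * c)
    (.eq (.mul (.const a) (.add (.const b) (.var 0)))
      (.add (.const (a * b)) (.mul (.const a) (.var 0))))
    (by rw [hM.out.mul_zero, hM.out.add_zero, hM.out.add_zero])
    (fun n h => by rw [hM.out.add_succ, hM.out.mul_succ, h, hM.out.mul_succ, num_add_assoc]) c

theorem num_mul_assoc (a b c : M.Num) : a * b * c = a * (b * c) :=
  bdd_induction (P := fun c : M.Num => a * b * c = a * (b * c))
    (.eq (.mul (.const (a * b)) (.var 0)) (.mul (.const a) (.mul (.const b) (.var 0))))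
    (by rw [hM.out.mul_zero, hM.out.mul_zero, hM.out.mul_zero])
    (fun n h => by rw [hM.out.mul_succ, h, hM.out.mul_succ, num_mul_add]) c

theorem num_mul_one (a : M.Num) : a * 1 = a := by
  rw [← num_zero_add (1 : M.Num), hM.out.mul_succ, hM.out.mul_zero, num_zero_add]

theorem num_add_left_cancel (a b c : M.Num) (h : a + b = a + c) : b = c := by
  revert h
  have := bdd_induction (P := fun a : M.Num => ¬ (a + b = a + c ∧ ¬ b = c))
    (.neg (.conj (.eq (.add (.var 0) (.const b)) (.add (.var 0) (.const c)))
      (.neg (.eq (.const b) (.const c)))))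
    (by rw [num_zero_add, num_zero_add]; tauto)
    (fun n h => by
      rintro ⟨h₁, h₂⟩
      rw [num_succ_add, num_succ_add] at h₁
      exact h ⟨hM.out.succ_inj _ _ h₁, h₂⟩) a
  tauto

/-- The axioms determine the order: it is the one given by addition. The direction from left to
right is an instance of `Σ⁰₁` induction, on the existence of the difference. -/
theorem num_lt_iff (a b : M.Num) : a < b ↔ ∃ c, b = a + (c + 1) := by
  constructor
  · have := sigma_induction (P := fun c b : M.Num => ¬ (a < b ∧ ¬ b = a + (c + 1)))
      (.neg (.conj (.lt (.const a) (.var 1))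
        (.neg (.eq (.var 1) (.add (.const a) (.add (.var 0) (.const 1)))))))
      ⟨0, fun h => hM.out.not_lt_zero _ h.1⟩
      (by
        rintro n ⟨m, hm⟩
        rcases em (a < n) with h | h
        · refine ⟨m + 1, fun h' => h'.2 ?_⟩
          rw [hM.out.add_succ, ← not_not (a := n = _).1 fun h'' => hm ⟨h, h''⟩]
        · refine ⟨0, fun h' => h'.2 ?_⟩
          rcases (hM.out.lt_succ _ _).1 h'.1 with h'' | rfl
          · exact absurd h'' h
          · rw [num_zero_add]) b
    obtain ⟨m, hm⟩ := this
    exact fun h => ⟨m, by tauto⟩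
  · rintro ⟨c, rfl⟩
    refine bdd_induction (P := fun c : M.Num => a < a + (c + 1))
      (.lt (.const a) (.add (.const a) (.add (.var 0) (.const 1)))) ?_ (fun n h => ?_) c
    · rw [num_zero_add, hM.out.lt_succ]; exact .inr rfl
    · rw [hM.out.add_succ _ (n + 1), hM.out.lt_succ]; exact .inl h

theorem num_eq_zero_or_succ (a : M.Num) : a = 0 ∨ ∃ b, a = b + 1 := by
  have := sigma_induction (P := fun b a : M.Num => ¬ (¬ a = 0 ∧ ¬ a = b + 1))
    (.neg (.conj (.neg (.eq (.var 1) (.const 0)))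
      (.neg (.eq (.var 1) (.add (.var 0) (.const 1))))))
    ⟨0, by tauto⟩ (fun n _ => ⟨n, by tauto⟩) a
  obtain ⟨b, hb⟩ := this
  by_cases h : a = 0
  · exact .inl h
  · exact .inr ⟨b, by tauto⟩

theorem num_lt_irrefl (a : M.Num) : ¬ a < a := by
  rw [num_lt_iff]
  rintro ⟨c, hc⟩
  conv_lhs at hc => rw [← hM.out.add_zero a]
  exact hM.out.succ_ne_zero _ (num_add_left_cancel _ _ _ hc).symm

theorem num_lt_trans {a b c : M.Num} (h₁ : a < b) (h₂ : b < c) : a < c := by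
  rw [num_lt_iff] at *
  obtain ⟨d, rfl⟩ := h₁
  obtain ⟨e, rfl⟩ := h₂
  exact ⟨d + 1 + e, by rw [num_add_assoc, num_add_assoc (d + 1)]⟩

theorem num_lt_trichotomy (a b : M.Num) : a < b ∨ a = b ∨ b < a := by
  have := bdd_induction (P := fun b : M.Num => ¬ (¬ a < b ∧ (¬ a = b ∧ ¬ b < a)))
    (.neg (.conj (.neg (.lt (.const a) (.var 0))) (.conj (.neg (.eq (.const a) (.var 0)))
      (.neg (.lt (.var 0) (.const a))))))
    (by
      rcases num_eq_zero_or_succ a with rfl | ⟨b, rfl⟩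
      · tauto
      · have : 0 < b + 1 := (num_lt_iff _ _).2 ⟨b, by rw [num_zero_add]⟩
        tauto)
    (fun n h => by
      rw [hM.out.lt_succ]
      rintro ⟨h₁, h₂, h₃⟩
      have : n < a := by tauto
      obtain ⟨c, rfl⟩ := (num_lt_iff _ _).1 this
      rcases num_eq_zero_or_succ c with rfl | ⟨c, rfl⟩
      · rw [num_zero_add] at h₂; exact h₂ rfl
      · refine h₃ ((num_lt_iff _ _).2 ⟨c, ?_⟩)
        exact (hM.out.add_succ n (c + 1)).trans (num_succ_add n (c + 1)).symm) b
  tauto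

instance : CommSemiring M.Num where
  add_assoc := num_add_assoc
  zero_add := num_zero_add
  add_zero := hM.out.add_zero
  add_comm := num_add_comm
  mul_assoc := num_mul_assoc
  mul_comm := num_mul_comm
  left_distrib := num_mul_add
  right_distrib a b c := by
    rw [num_mul_comm, num_mul_add, num_mul_comm c a, num_mul_comm c b]
  zero_mul := num_zero_mul
  mul_zero := hM.out.mul_zero
  one_mul a := by rw [num_mul_comm, num_mul_one]
  mul_one := num_mul_one
  nsmul := nsmulRec

noncomputable instance : LinearOrder M.Num where
  le a b := a < b ∨ a = b
  le_refl a := .inr rfl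
  le_trans a b c := by
    rintro (h₁ | rfl) (h₂ | rfl)
    · exact .inl (num_lt_trans h₁ h₂)
    · exact .inl h₁
    · exact .inl h₂
    · exact .inr rfl
  lt_iff_le_not_ge a b := by
    constructor
    · intro h
      refine ⟨.inl h, ?_⟩
      rintro (h' | rfl)
      · exact num_lt_irrefl _ (num_lt_trans h h')
      · exact num_lt_irrefl _ h
    · rintro ⟨h | rfl, h'⟩
      · exact h
      · exact absurd (.inr rfl) h'
  le_antisymm a b := by
    rintro (h₁ | rfl) (h₂ | h₂)
    · exact absurd (num_lt_trans h₁ h₂) (num_lt_irrefl _)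
    · exact h₂.symm
    · rfl
    · rfl
  le_total a b := by have := num_lt_trichotomy a b; tauto
  toDecidableLE := Classical.decRel _

theorem num_le_iff {a b : M.Num} : a ≤ b ↔ ∃ c, b = a + c := by
  constructor
  · rintro (h | rfl)
    · obtain ⟨c, rfl⟩ := (num_lt_iff _ _).1 h; exact ⟨_, rfl⟩
    · exact ⟨0, (add_zero _).symm⟩
  · rintro ⟨c, rfl⟩
    rcases num_eq_zero_or_succ c with rfl | ⟨c, rfl⟩
    · exact .inr (add_zero _).symm
    · exact .inl ((num_lt_iff _ _).2 ⟨c, rfl⟩)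

theorem num_lt_succ_iff {a b : M.Num} : a < b + 1 ↔ a ≤ b := hM.out.lt_succ a b

theorem num_succ_le_iff {a b : M.Num} : a + 1 ≤ b ↔ a < b := by
  rw [num_le_iff, num_lt_iff]
  simp only [add_assoc, add_comm (1 : M.Num)]

instance : CanonicallyOrderedAdd M.Num where
  le_add_self _ b := num_le_iff.2 ⟨b, add_comm _ _⟩
  le_self_add _ b := num_le_iff.2 ⟨b, rfl⟩
  exists_add_of_le h := num_le_iff.1 h

instance : IsCancelAdd M.Num where
  add_left_cancel a b c h := num_add_left_cancel a b c h
  add_right_cancel a b c h := num_add_left_cancel a b c (by simpa [add_comm] using h)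

instance : IsStrictOrderedRing M.Num where
  add_le_add_left _ _ h _ := by
    obtain ⟨d, rfl⟩ := num_le_iff.1 h
    exact num_le_iff.2 ⟨d, by ring⟩
  le_of_add_le_add_left _ _ _ h := by
    obtain ⟨d, hd⟩ := num_le_iff.1 h
    rw [add_assoc] at hd
    exact num_le_iff.2 ⟨d, num_add_left_cancel _ _ _ hd⟩
  zero_le_one := num_le_iff.2 ⟨1, (zero_add _).symm⟩
  exists_pair_ne := ⟨0, 1, fun h => hM.out.succ_ne_zero 0 (by rw [zero_add]; exact h.symm)⟩
  mul_lt_mul_of_pos_left _ ha b c h := by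
    obtain ⟨d, rfl⟩ := (num_lt_iff _ _).1 h
    obtain ⟨e, rfl⟩ := (num_lt_iff _ _).1 ha
    exact (num_lt_iff _ _).2 ⟨e * d + e + d, by ring⟩
  mul_lt_mul_of_pos_right _ ha b c h := by
    obtain ⟨d, rfl⟩ := (num_lt_iff _ _).1 h
    obtain ⟨e, rfl⟩ := (num_lt_iff _ _).1 ha
    exact (num_lt_iff _ _).2 ⟨e * d + e + d, by ring⟩

theorem num_lt_succ_self (a : M.Num) : a < a + 1 := num_lt_succ_iff.2 le_rfl

/-! ### The pairing function -/

theorem left_le_pair (i j : M.Num) : i ≤ pair i j := le_add_self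

theorem num_le_mul_self (a : M.Num) : a ≤ a * a := by
  rcases num_eq_zero_or_succ a with rfl | ⟨b, rfl⟩
  · simp
  · exact num_le_iff.2 ⟨b * b + b, by ring⟩

theorem right_le_pair (i j : M.Num) : j ≤ pair i j :=
  (le_add_self.trans (num_le_mul_self (i + j))).trans le_self_add

theorem pair_lt_of_add_lt {i j i' j' : M.Num} (h : i + j < i' + j') : pair i j < pair i' j' := by
  obtain ⟨c, hc⟩ := (num_lt_iff _ _).1 h
  unfold pair
  rw [hc, num_lt_iff]
  exact ⟨2 * (i + j) * c + (i + j) + j + c * c + 2 * c + i', by ring⟩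

theorem pair_inj {i j i' j' : M.Num} : pair i j = pair i' j' ↔ i = i' ∧ j = j' := by
  refine ⟨fun h => ?_, fun h => by rw [h.1, h.2]⟩
  rcases lt_trichotomy (i + j) (i' + j') with h' | h' | h'
  · exact absurd h (pair_lt_of_add_lt h').ne
  · unfold pair at h
    rw [h'] at h
    have : i = i' := add_left_cancel h
    subst this
    exact ⟨rfl, add_left_cancel h'⟩
  · exact absurd h (pair_lt_of_add_lt h').ne'

/-! ### `Σ⁰₁` and `Δ⁰₁` relations, and functions with `Σ⁰₁` graph -/

/-- The `k`-ary relations which are `Σ⁰₁` with parameters from `M`. The three notions of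
definability below are classes, so that the definability of a concrete relation is found by
instance search along its syntax. -/
class S1 {k : ℕ} (P : (Fin k → M.Num) → Prop) : Prop where
  out : ∃ Q : (Fin (k + 1) → M.Num) → Prop, Bdd Q ∧
    ∀ x, P x ↔ ∃ m, Q (Fin.cons m x : Fin (k + 1) → M.Num)

/-- The `k`-ary relations which are `Δ⁰₁` with parameters from `M`. -/
class D1 {k : ℕ} (P : (Fin k → M.Num) → Prop) : Prop where
  pos : S1 P
  neg : S1 (fun x => ¬ P x)

/-- The `k`-ary functions of the model which are computable relative to sets of `M`: those with a
`Σ⁰₁` graph. The value is variable `0` of the graph. -/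
class Comp {k : ℕ} (f : (Fin k → M.Num) → M.Num) : Prop where
  graph : S1 (fun z : Fin (k + 1) → M.Num => z 0 = f (fun i => z i.succ))

section
omit hM

theorem S1.congr {k : ℕ} {P Q : (Fin k → M.Num) → Prop} (hP : S1 P) (h : ∀ x, Q x ↔ P x) :
    S1 Q := by
  have : Q = P := funext fun x => propext (h x)
  rwa [this]

theorem D1.congr {k : ℕ} {P Q : (Fin k → M.Num) → Prop} (hP : D1 P) (h : ∀ x, Q x ↔ P x) :
    D1 Q := by
  have : Q = P := funext fun x => propext (h x)
  rwa [this]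

theorem S1.reindex {k : ℕ} {P : (Fin k → M.Num) → Prop} (hP : S1 P) {m : ℕ} (r : Fin k → Fin m) :
    S1 (fun z : Fin m → M.Num => P (fun i => z (r i))) := by
  obtain ⟨Q, hQ, h⟩ := hP.out
  exact ⟨fun z => Q (Fin.cons (z 0) fun i => z (r i).succ),
    hQ.subst_cons (.var 0) fun i => .var (r i).succ, fun x => by simp [h]⟩

theorem D1.reindex {k : ℕ} {P : (Fin k → M.Num) → Prop} (hP : D1 P) {m : ℕ} (r : Fin k → Fin m) :
    D1 (fun z : Fin m → M.Num => P (fun i => z (r i))) :=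
  ⟨hP.pos.reindex r, hP.neg.reindex r⟩

theorem Bdd.s1 {k : ℕ} {P : (Fin k → M.Num) → Prop} (hP : Bdd P) : S1 P :=
  ⟨⟨_, hP.reindex Fin.succ, fun x => by simp⟩⟩

theorem Bdd.d1 {k : ℕ} {P : (Fin k → M.Num) → Prop} (hP : Bdd P) : D1 P :=
  ⟨hP.s1, (Bdd.neg hP).s1⟩

instance (priority := low) S1.of_d1 {k : ℕ} {P : (Fin k → M.Num) → Prop} [h : D1 P] : S1 P := h.pos

instance S1.or {k : ℕ} {P Q : (Fin k → M.Num) → Prop} [hP : S1 P] [hQ : S1 Q] :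
    S1 (fun x => P x ∨ Q x) := by
  obtain ⟨P', hP', hP⟩ := hP.out
  obtain ⟨Q', hQ', hQ⟩ := hQ.out
  exact ⟨_, hP'.or hQ', fun x => by rw [hP, hQ, exists_or]⟩

end

instance S1.ex {k : ℕ} {P : (Fin k → M.Num) → M.Num → Prop}
    [hP : S1 (fun z : Fin (k + 1) → M.Num => P (fun i => z i.succ) (z 0))] :
    S1 (fun x => ∃ y, P x y) := by
  obtain ⟨Q, hQ, h⟩ := hP.out
  refine ⟨fun z => ∃ y, y < z 0 + 1 ∧ ∃ m, m < z 0 + 1 ∧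
    Q (Fin.cons m (Fin.cons y fun i => z i.succ)), ?_, fun x => ?_⟩
  · refine .bex (P := fun z y => ∃ m, m < z 0 + 1 ∧ Q (Fin.cons m (Fin.cons y fun i => z i.succ)))
      (.add (.var 0) (.const 1)) (.bex (P := fun w m =>
        Q (Fin.cons m (Fin.cons (w 0) fun i => w i.succ.succ)))
        (.add (.var 1) (.const 1)) ?_)
    exact hQ.subst_cons₂ (.var 0) (.var 1) fun i => .var i.succ.succ.succ
  · have key : ∀ y, P x y ↔ ∃ m, Q (Fin.cons m (Fin.cons y x)) := fun y => by
      simpa using h (Fin.cons y x)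
    simp only [key, Fin.cons_zero, Fin.cons_succ]
    constructor
    · rintro ⟨y, m, hm⟩
      exact ⟨y + m, y, num_lt_succ_iff.2 le_self_add, m, num_lt_succ_iff.2 le_add_self, hm⟩
    · rintro ⟨_, y, _, m, _, hm⟩
      exact ⟨y, m, hm⟩

instance S1.and {k : ℕ} {P Q : (Fin k → M.Num) → Prop} [hP : S1 P] [hQ : S1 Q] :
    S1 (fun x => P x ∧ Q x) := by
  obtain ⟨P', hP', hP⟩ := hP.out
  obtain ⟨Q', hQ', hQ⟩ := hQ.out
  -- `P x ∧ Q x` is written as `∃ a b, P' (a, x) ∧ Q' (b, x)`, the two witnesses being variables.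
  have h₁ : S1 (fun z : Fin (k + 2) → M.Num => P' (Fin.cons (z 0) fun i => z i.succ.succ) ∧
      Q' (Fin.cons (z 1) fun i => z i.succ.succ)) :=
    (Bdd.conj (hP'.subst_cons (.var 0) fun i => .var i.succ.succ)
      (hQ'.subst_cons (.var 1) fun i => .var i.succ.succ)).s1
  refine (S1.ex (P := fun x b => ∃ a, P' (Fin.cons a x) ∧ Q' (Fin.cons b x))
    (hP := S1.ex (P := fun z a => P' (Fin.cons a fun i => z i.succ) ∧
      Q' (Fin.cons (z 0) fun i => z i.succ)) (hP := h₁))).congr fun x => ?_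
  rw [hP, hQ]
  exact ⟨fun ⟨⟨a, ha⟩, b, hb⟩ => ⟨b, a, ha, hb⟩, fun ⟨b, a, ha, hb⟩ => ⟨⟨a, ha⟩, b, hb⟩⟩

/-- Bounded collection. -/
theorem Bdd.collection {R : M.Num → M.Num → Prop}
    (hR : Bdd (fun z : Fin 2 → M.Num => R (z 0) (z 1))) (a : M.Num)
    (h : ∀ y, y < a → ∃ m, R y m) : ∃ b, ∀ y, y < a → ∃ m, m < b ∧ R y m := by
  have key := sigma_induction
    (P := fun b n => ∀ y, y < n → ∃ m, m < b ∧ (a < y + 1 ∨ R y m))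
    (.ball (P := fun z y => ∃ m, m < z 0 ∧ (a < y + 1 ∨ R y m)) (.var 1)
      (.bex (P := fun z m => a < z 0 + 1 ∨ R (z 0) m) (.var 1)
        (.or (.lt (.const a) (.add (.var 1) (.const 1))) (hR.reindex ![1, 0]))))
    ⟨0, fun y hy => absurd hy (hM.out.not_lt_zero y)⟩
    (by
      rintro n ⟨b, hb⟩
      obtain ⟨m, hm⟩ : ∃ m, a < n + 1 ∨ R n m := by
        rcases lt_or_ge n a with h' | h'
        · obtain ⟨m, hm⟩ := h n h'; exact ⟨m, .inr hm⟩
        · exact ⟨0, .inl (num_lt_succ_iff.2 h')⟩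
      refine ⟨b + (m + 1), fun y hy => ?_⟩
      rcases (num_lt_succ_iff.1 hy).lt_or_eq with hy | rfl
      · obtain ⟨m', hm', h'⟩ := hb y hy
        exact ⟨m', hm'.trans_le le_self_add, h'⟩
      · exact ⟨m, (num_lt_succ_self m).trans_le le_add_self, hm⟩)
    a
  obtain ⟨b, hb⟩ := key
  refine ⟨b, fun y hy => ?_⟩
  obtain ⟨m, hm, h' | h'⟩ := hb y hy
  · exact absurd (num_lt_succ_iff.1 h') (not_le.2 hy)
  · exact ⟨m, hm, h'⟩

/-- `Σ⁰₁` relations are closed under bounded universal quantification, by collection. -/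
theorem S1.ball_var {k : ℕ} {P : (Fin k → M.Num) → M.Num → Prop} (j : Fin k)
    (hP : S1 (fun z : Fin (k + 1) → M.Num => P (fun i => z i.succ) (z 0))) :
    S1 (fun x => ∀ y, y < x j → P x y) := by
  obtain ⟨Q, hQ, h⟩ := hP.out
  refine ⟨fun z => ∀ y, y < z j.succ → ∃ m, m < z 0 ∧
    Q (Fin.cons m (Fin.cons y fun i => z i.succ)), ?_, fun x => ?_⟩
  · refine .ball (P := fun z y => ∃ m, m < z 0 ∧ Q (Fin.cons m (Fin.cons y fun i => z i.succ)))
      (.var _) (.bex (P := fun w m => Q (Fin.cons m (Fin.cons (w 0) fun i => w i.succ.succ)))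
        (.var 1) ?_)
    exact hQ.subst_cons₂ (.var 0) (.var 1) fun i => .var i.succ.succ.succ
  · have key : ∀ y, P x y ↔ ∃ m, Q (Fin.cons m (Fin.cons y x)) := fun y => by
      simpa using h (Fin.cons y x)
    simp only [key, Fin.cons_zero, Fin.cons_succ]
    constructor
    · exact Bdd.collection (R := fun y m => Q (Fin.cons m (Fin.cons y x)))
        (hQ.subst_cons₂ (.var 1) (.var 0) fun i => .const (x i)) _
    · rintro ⟨b, hb⟩ y hy
      obtain ⟨m, _, hm⟩ := hb y hy
      exact ⟨m, hm⟩

omit hM in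
theorem Comp.reindex {k : ℕ} {f : (Fin k → M.Num) → M.Num} (hf : Comp f) {m : ℕ}
    (r : Fin k → Fin m) : Comp (fun z : Fin m → M.Num => f (fun i => z (r i))) :=
  ⟨hf.graph.reindex (Fin.cases 0 fun i => (r i).succ)⟩

/-- A computable function may be substituted into a `Σ⁰₁` relation: `P x (f x)` says that
`P x y` for some `y = f x`. -/
theorem S1.subst {k : ℕ} {P : (Fin k → M.Num) → M.Num → Prop}
    (hP : S1 (fun z : Fin (k + 1) → M.Num => P (fun i => z i.succ) (z 0)))
    {f : (Fin k → M.Num) → M.Num} (hf : Comp f) : S1 (fun x => P x (f x)) := by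
  have := hf.graph
  exact (S1.ex (P := fun x y => y = f x ∧ P x y) (hP := S1.and)).congr fun x => by simp

theorem D1.subst {k : ℕ} {P : (Fin k → M.Num) → M.Num → Prop}
    (hP : D1 (fun z : Fin (k + 1) → M.Num => P (fun i => z i.succ) (z 0)))
    {f : (Fin k → M.Num) → M.Num} (hf : Comp f) : D1 (fun x => P x (f x)) :=
  ⟨S1.subst hP.pos hf, S1.subst (P := fun x y => ¬ P x y) hP.neg hf⟩

theorem Comp.subst {k : ℕ} {g : (Fin k → M.Num) → M.Num → M.Num}
    (hg : Comp (fun z : Fin (k + 1) → M.Num => g (fun i => z i.succ) (z 0)))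
    {f : (Fin k → M.Num) → M.Num} (hf : Comp f) : Comp (fun x => g x (f x)) :=
  ⟨S1.subst (P := fun z y => z 0 = g (fun i => z i.succ) y)
    (hg.graph.reindex (Fin.cases 1 (Fin.cases 0 fun i => i.succ.succ)))
    (hf.reindex Fin.succ)⟩

/-- The lemmas `comp₁`, `comp₂`, `comp₃` reduce an instance for `R (f x) (g x)` with arbitrary
computable `f` and `g` to the case in which `f x` and `g x` are variables, so that `R` may be
unfolded there. -/
theorem D1.comp₁ {R : M.Num → Prop} (hR : D1 (fun x : Fin 1 → M.Num => R (x 0)))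
    {k : ℕ} {f : (Fin k → M.Num) → M.Num} (hf : Comp f) : D1 (fun x => R (f x)) :=
  D1.subst (P := fun _ y => R y) (hR.reindex ![0]) hf

theorem D1.comp₂ {R : M.Num → M.Num → Prop} (hR : D1 (fun x : Fin 2 → M.Num => R (x 0) (x 1)))
    {k : ℕ} {f g : (Fin k → M.Num) → M.Num} (hf : Comp f) (hg : Comp g) :
    D1 (fun x => R (f x) (g x)) :=
  D1.subst (P := fun x y => R y (g x))
    (D1.subst (P := fun z y => R (z 0) y) (hR.reindex ![1, 0]) (hg.reindex Fin.succ)) hf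

theorem D1.comp₃ {R : M.Num → M.Num → M.Num → Prop}
    (hR : D1 (fun x : Fin 3 → M.Num => R (x 0) (x 1) (x 2)))
    {k : ℕ} {f g h : (Fin k → M.Num) → M.Num} (hf : Comp f) (hg : Comp g) (hh : Comp h) :
    D1 (fun x => R (f x) (g x) (h x)) :=
  D1.subst (P := fun x y => R y (g x) (h x))
    (D1.subst (P := fun z y => R (z 0) y (h fun i => z i.succ))
      (D1.subst (P := fun z y => R (z 1) (z 0) y) (hR.reindex ![2, 1, 0])
        (hh.reindex fun i => i.succ.succ)) (hg.reindex Fin.succ)) hf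

theorem Comp.comp₁ {h : M.Num → M.Num} (hh : Comp (fun x : Fin 1 → M.Num => h (x 0)))
    {k : ℕ} {f : (Fin k → M.Num) → M.Num} (hf : Comp f) : Comp (fun x => h (f x)) :=
  Comp.subst (g := fun _ y => h y) (hh.reindex ![0]) hf

theorem Comp.comp₂ {h : M.Num → M.Num → M.Num}
    (hh : Comp (fun x : Fin 2 → M.Num => h (x 0) (x 1)))
    {k : ℕ} {f g : (Fin k → M.Num) → M.Num} (hf : Comp f) (hg : Comp g) :
    Comp (fun x => h (f x) (g x)) :=
  Comp.subst (g := fun x y => h y (g x))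
    (Comp.subst (g := fun z y => h (z 0) y) (hh.reindex ![1, 0]) (hg.reindex Fin.succ)) hf

section
omit hM

theorem Poly.comp {k : ℕ} {f : (Fin k → M.Num) → M.Num} (hf : Poly f) : Comp f :=
  ⟨(Bdd.eq (.var 0) (hf.subst fun i => .var i.succ)).s1⟩

instance (priority := high) Comp.var {k : ℕ} (i : Fin k) : Comp (fun x : Fin k → M.Num => x i) :=
  (Poly.var i).comp

instance (priority := high) Comp.const {k : ℕ} (a : M.Num) : Comp (fun _ : Fin k → M.Num => a) :=
  (Poly.const a).comp

end

section instances

variable {k : ℕ} {P Q : (Fin k → M.Num) → Prop} {f g : (Fin k → M.Num) → M.Num}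
  {R : (Fin k → M.Num) → M.Num → Prop}

instance Comp.add [hf : Comp f] [hg : Comp g] : Comp (fun x => f x + g x) :=
  Comp.comp₂ (h := fun a b => a + b) (Poly.add (.var 0) (.var 1)).comp hf hg

instance Comp.mul [hf : Comp f] [hg : Comp g] : Comp (fun x => f x * g x) :=
  Comp.comp₂ (h := fun a b => a * b) (Poly.mul (.var 0) (.var 1)).comp hf hg

instance Comp.comp_pair [Comp f] [Comp g] : Comp (fun x => pair (f x) (g x)) := by
  unfold pair; infer_instance

instance (priority := high) D1.const (p : Prop) : D1 (fun _ : Fin k → M.Num => p) := by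
  by_cases h : p
  · exact (Bdd.eq (.const 0) (.const 0)).d1.congr fun _ => by simp [h]
  · exact (Bdd.neg (.eq (.const 0) (.const 0))).d1.congr fun _ => by simp [h]

instance D1.eq [hf : Comp f] [hg : Comp g] : D1 (fun x => f x = g x) :=
  D1.comp₂ (R := fun a b => a = b) (Bdd.eq (.var 0) (.var 1)).d1 hf hg

instance D1.lt [hf : Comp f] [hg : Comp g] : D1 (fun x => f x < g x) :=
  D1.comp₂ (R := fun a b => a < b) (Bdd.lt (.var 0) (.var 1)).d1 hf hg

instance D1.mem {X : Set M.Num} [hX : Fact (X ∈ M.Sets)] [hf : Comp f] : D1 (fun x => f x ∈ X) :=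
  D1.comp₁ (R := fun a => a ∈ X) (Bdd.mem (.var 0) hX.out).d1 hf

instance D1.mem_sec {Z : Set M.Num} [hZ : Fact (Z ∈ M.Sets)] [hf : Comp f] [hg : Comp g] :
    D1 (fun x => f x ∈ sec Z (g x)) :=
  inferInstanceAs (D1 (fun x => L2Structure.pair (g x) (f x) ∈ Z))

instance D1.not [hP : D1 P] : D1 (fun x => ¬ P x) :=
  ⟨hP.neg, by simpa only [not_not] using hP.pos⟩

instance D1.and [hP : D1 P] [hQ : D1 Q] : D1 (fun x => P x ∧ Q x) := by
  have := hP.pos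
  have := hP.neg
  have := hQ.pos
  have := hQ.neg
  exact ⟨inferInstance, by simp only [not_and_or]; infer_instance⟩

instance D1.or [D1 P] [D1 Q] : D1 (fun x => P x ∨ Q x) :=
  D1.congr (P := fun x => ¬ (¬ P x ∧ ¬ Q x)) inferInstance fun x => by tauto

instance D1.imp [D1 P] [D1 Q] : D1 (fun x => P x → Q x) :=
  D1.congr (P := fun x => ¬ P x ∨ Q x) inferInstance fun x => by tauto

instance D1.iff [D1 P] [D1 Q] : D1 (fun x => P x ↔ Q x) :=
  D1.congr (P := fun x => (P x → Q x) ∧ (Q x → P x)) inferInstance fun x => by tauto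

instance S1.ball [hf : Comp f]
    [hR : S1 (fun z : Fin (k + 1) → M.Num => R (fun i => z i.succ) (z 0))] :
    S1 (fun x => ∀ y, y < f x → R x y) :=
  S1.subst (P := fun x b => ∀ y, y < b → R x y)
    (S1.ball_var (P := fun z y => R (fun i => z i.succ) y) 0
      (hR.reindex (Fin.cases 0 fun i => i.succ.succ))) hf

instance D1.ball [hf : Comp f]
    [hR : D1 (fun z : Fin (k + 1) → M.Num => R (fun i => z i.succ) (z 0))] :
    D1 (fun x => ∀ y, y < f x → R x y) := by
  have := hf.graph
  have := hR.pos
  have := hR.neg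
  have h : D1 (fun z : Fin (k + 1) → M.Num => z 0 < f (fun i => z i.succ)) :=
    D1.lt (hg := hf.reindex Fin.succ)
  exact ⟨inferInstance, S1.congr (P := fun x => ∃ y, y < f x ∧ ¬ R x y)
    (S1.ex (hP := S1.and)) fun x => by push Not; rfl⟩

instance D1.bex [Comp f] [D1 (fun z : Fin (k + 1) → M.Num => R (fun i => z i.succ) (z 0))] :
    D1 (fun x => ∃ y, y < f x ∧ R x y) :=
  D1.congr (P := fun x => ¬ ∀ y, y < f x → ¬ R x y) inferInstance fun x => by push Not; rfl

instance D1.ball_le [Comp f] [D1 (fun z : Fin (k + 1) → M.Num => R (fun i => z i.succ) (z 0))] :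
    D1 (fun x => ∀ y, y ≤ f x → R x y) := by
  simp only [← num_lt_succ_iff]; infer_instance

instance D1.bex_le [Comp f] [D1 (fun z : Fin (k + 1) → M.Num => R (fun i => z i.succ) (z 0))] :
    D1 (fun x => ∃ y, y ≤ f x ∧ R x y) := by
  simp only [← num_lt_succ_iff]; infer_instance

end instances

/-! ### Induction, minimization and comprehension -/

theorem S1.induction {P : M.Num → Prop} (hP : S1 (fun x : Fin 1 → M.Num => P (x 0))) (h₀ : P 0)
    (h₁ : ∀ n, P n → P (n + 1)) (n : M.Num) : P n := by
  obtain ⟨Q, hQ, h⟩ := hP.out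
  have key : ∀ n, P n ↔ ∃ m, Q ![m, n] := fun n => h ![n]
  rw [key] at *
  simp only [key] at h₁
  refine sigma_induction (P := fun m n => Q ![m, n]) ?_ h₀ h₁ n
  convert hQ using 3 with x
  funext i; fin_cases i <;> rfl

theorem D1.induction {P : M.Num → Prop} (hP : D1 (fun x : Fin 1 → M.Num => P (x 0))) (h₀ : P 0)
    (h₁ : ∀ n, P n → P (n + 1)) (n : M.Num) : P n :=
  S1.induction hP.pos h₀ h₁ n

/-- The least number principle. -/
theorem D1.exists_least {P : M.Num → Prop} (hP : D1 (fun x : Fin 1 → M.Num => P (x 0)))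
    (h : ∃ n, P n) : ∃ n, P n ∧ ∀ m, m < n → ¬ P m := by
  by_contra! hc
  obtain ⟨n, hn⟩ := h
  have hP' : D1 (fun x : Fin 2 → M.Num => P (x 0)) := hP.reindex ![0]
  have key := D1.induction (P := fun n => ∀ m, m < n → ¬ P m) inferInstance
    (fun m hm => absurd hm (hM.out.not_lt_zero m))
    (fun n ih m hm hPm => by
      rcases (num_lt_succ_iff.1 hm).lt_or_eq with h | rfl
      · exact ih m h hPm
      · obtain ⟨m', h', hm'⟩ := hc m hPm
        exact ih m' h' hm') (n + 1)
  exact key n (num_lt_succ_self n) hn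

/-- `Δ⁰₁` comprehension. -/
theorem D1.setOf_mem {P : M.Num → Prop} (hP : D1 (fun x : Fin 1 → M.Num => P (x 0))) :
    {n | P n} ∈ M.Sets := by
  obtain ⟨Q, hQ, h⟩ := hP.pos.out
  obtain ⟨Q', hQ', h'⟩ := hP.neg.out
  have key : ∀ n, P n ↔ ∃ m, Q ![m, n] := fun n => h ![n]
  have key' : ∀ n, ¬ P n ↔ ∃ m, Q' ![m, n] := fun n => h' ![n]
  have e : ∀ x : Fin 2 → M.Num, ![x 0, x 1] = x := fun x => by
    funext i; fin_cases i <;> rfl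
  obtain ⟨X, hX, hX'⟩ := delta_comprehension (P := fun m n => Q ![m, n])
    (Q := fun m n => ¬ Q' ![m, n]) (by simpa only [e] using hQ) (by simpa only [e] using hQ'.neg)
    (fun n => by rw [← key, ← not_exists, ← key', not_not])
  have : {n | P n} = X := Set.ext fun n => by rw [hX', ← key]; rfl
  exact this ▸ hX

/-- Comprehension for a sequence of sets. -/
theorem D1.exists_seq {P : M.Num → M.Num → Prop}
    (hP : D1 (fun x : Fin 2 → M.Num => P (x 0) (x 1))) :
    ∃ Z ∈ M.Sets, ∀ k n, n ∈ sec Z k ↔ P k n := by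
  have {k : ℕ} {f g : (Fin k → M.Num) → M.Num} [Comp f] [Comp g] : D1 (fun x => P (f x) (g x)) :=
    D1.comp₂ hP inferInstance inferInstance
  refine ⟨_, D1.setOf_mem (P := fun x => ∃ k, k ≤ x ∧ ∃ n, n ≤ x ∧ x = pair k n ∧ P k n)
    inferInstance, fun k n => ?_⟩
  simp only [sec, Set.mem_ofPred_eq, pair_inj]
  exact ⟨fun ⟨_, _, _, _, ⟨h₁, h₂⟩, h⟩ => by rwa [h₁, h₂],
    fun h => ⟨k, left_le_pair _ _, n, right_le_pair _ _, ⟨rfl, rfl⟩, h⟩⟩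

/-! ### Codes of finite sets -/

theorem num_pos_iff_succ {a : M.Num} : 0 < a ↔ ∃ b, a = b + 1 := by
  rw [num_lt_iff]; simp only [zero_add]

theorem num_dvd_of_dvd_add {p a b : M.Num} (hp : 0 < p) (h₁ : p ∣ a) (h₂ : p ∣ a + b) : p ∣ b := by
  obtain ⟨c, rfl⟩ := h₁
  obtain ⟨d, hd⟩ := h₂
  obtain ⟨e, rfl⟩ := num_le_iff.1 (le_of_mul_le_mul_left (hd ▸ le_self_add : p * c ≤ p * d) hp)
  exact ⟨e, add_left_cancel (hd.trans (mul_add p c e))⟩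

theorem num_dvd_iff {a b : M.Num} : a ∣ b ↔ ∃ d, d ≤ b ∧ b = a * d := by
  refine ⟨fun ⟨d, hd⟩ => ?_, fun ⟨d, _, hd⟩ => ⟨d, hd⟩⟩
  rcases num_eq_zero_or_succ a with rfl | ⟨a, rfl⟩
  · exact ⟨0, zero_le, by simpa using hd⟩
  · exact ⟨d, by rw [hd, add_mul, one_mul]; exact le_add_self, hd⟩

instance D1.dvd {k : ℕ} {f g : (Fin k → M.Num) → M.Num} [Comp f] [Comp g] :
    D1 (fun x => f x ∣ g x) :=
  D1.comp₂ (R := fun a b => a ∣ b) (by simp only [num_dvd_iff]; infer_instance)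
    inferInstance inferInstance

theorem finMem_pair {i k m n : M.Num} :
    FinMem i (pair k (pair m n)) ↔ i < k ∧ (m * (i + 1) + 1) ∣ n := by
  constructor
  · rintro ⟨k', m', n', h, hi, hd⟩
    obtain ⟨rfl, h'⟩ := pair_inj.1 h
    obtain ⟨rfl, rfl⟩ := pair_inj.1 h'
    exact ⟨hi, hd⟩
  · rintro ⟨hi, hd⟩
    exact ⟨k, m, n, rfl, hi, hd⟩

theorem FinMem.lt {i c : M.Num} (h : FinMem i c) : i < c := by
  obtain ⟨k, m, n, rfl, hi, _⟩ := h
  exact hi.trans_le (left_le_pair _ _)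

theorem finMem_iff_bdd {i c : M.Num} : FinMem i c ↔ ∃ k, k ≤ c ∧ ∃ m, m ≤ c ∧ ∃ n, n ≤ c ∧
    (c = pair k (pair m n) ∧ i < k ∧ (m * (i + 1) + 1) ∣ n) := by
  constructor
  · rintro ⟨k, m, n, rfl, hi, hd⟩
    have := right_le_pair k (pair m n)
    exact ⟨k, left_le_pair _ _, m, (left_le_pair _ _).trans this, n,
      (right_le_pair _ _).trans this, rfl, hi, hd⟩
  · rintro ⟨k, _, m, _, n, _, h, hi, hd⟩
    exact ⟨k, m, n, h, hi, hd⟩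

instance D1.finMem {k : ℕ} {f g : (Fin k → M.Num) → M.Num} [Comp f] [Comp g] :
    D1 (fun x => FinMem (f x) (g x)) :=
  D1.comp₂ (R := fun a b => FinMem a b) (by simp only [finMem_iff_bdd]; infer_instance)
    inferInstance inferInstance

theorem exists_common_multiple (k : M.Num) : ∃ m : M.Num, 0 < m ∧ ∀ j, j < k → (j + 1) ∣ m := by
  refine S1.induction (P := fun k : M.Num => ∃ m : M.Num, 0 < m ∧ ∀ j, j < k → (j + 1) ∣ m)
    inferInstance ⟨1, zero_lt_one, fun j hj => absurd hj (hM.out.not_lt_zero j)⟩ ?_ k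
  rintro n ⟨m, hm, h⟩
  refine ⟨m * (n + 1), mul_pos hm (num_pos_iff_succ.2 ⟨n, rfl⟩), fun j hj => ?_⟩
  rcases (num_lt_succ_iff.1 hj).lt_or_eq with hj | rfl
  · exact (h j hj).mul_right _
  · exact dvd_mul_left _ _

/-- If `m` is a common multiple of `1, …, k`, then the moduli `m (i + 1) + 1` for `i < k` are
pairwise coprime, in the form in which this is used. -/
theorem dvd_of_dvd_mul_modulus {k m i b n : M.Num} (hm : ∀ j, j < k → (j + 1) ∣ m) (hi : i < k)
    (hb : b < k) (hib : i ≠ b) (h : (m * (i + 1) + 1) ∣ n * (m * (b + 1) + 1)) :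
    (m * (i + 1) + 1) ∣ n := by
  have hp : 0 < m * (i + 1) + 1 := num_pos_iff_succ.2 ⟨_, rfl⟩
  -- `m` is invertible modulo `m (i + 1) + 1`.
  have cancel : ∀ x, (m * (i + 1) + 1) ∣ x * m → (m * (i + 1) + 1) ∣ x := fun x hx => by
    refine num_dvd_of_dvd_add hp (a := x * m * (i + 1)) (hx.mul_right _) ⟨x, by ring⟩
  have key : ∃ j, j < k ∧ (m * (i + 1) + 1) ∣ n * (j + 1) * m := by
    rcases hib.lt_or_gt with hlt | hlt
    · obtain ⟨j, rfl⟩ := (num_lt_iff _ _).1 hlt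
      refine ⟨j, lt_of_lt_of_le (num_lt_succ_self j) (le_add_self.trans hb.le), ?_⟩
      refine num_dvd_of_dvd_add hp (a := n * (m * (i + 1) + 1)) (dvd_mul_left _ _) ?_
      convert h using 1; ring
    · obtain ⟨j, rfl⟩ := (num_lt_iff _ _).1 hlt
      refine ⟨j, lt_of_lt_of_le (num_lt_succ_self j) (le_add_self.trans hi.le), ?_⟩
      refine num_dvd_of_dvd_add hp h ⟨n, ?_⟩
      ring
  obtain ⟨j, hj, hd⟩ := key
  obtain ⟨e, he⟩ := hm j hj
  refine cancel n ?_
  have := (cancel _ hd).mul_right e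
  rwa [mul_assoc, ← he] at this

/-- Every bounded `Δ⁰₁` set has a code. -/
theorem D1.exists_finCode {P : M.Num → Prop} (hP : D1 (fun x : Fin 1 → M.Num => P (x 0)))
    (k : M.Num) : ∃ c, IsFinCode c ∧ ∀ i, FinMem i c ↔ i < k ∧ P i := by
  have {k : ℕ} {f : (Fin k → M.Num) → M.Num} [Comp f] : D1 (fun x => P (f x)) :=
    D1.comp₁ hP inferInstance
  obtain ⟨m, hm₀, hm⟩ := exists_common_multiple k
  have key : ∀ b, ∃ n, ∀ i, i < k → ((m * (i + 1) + 1) ∣ n ↔ i < b ∧ P i) := by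
    refine S1.induction inferInstance ⟨1, fun i _ => ?_⟩ fun b ⟨n, hn⟩ => ?_
    · refine iff_of_false (fun ⟨d, hd⟩ => ?_) fun h => hM.out.not_lt_zero _ h.1
      obtain ⟨m, rfl⟩ := num_pos_iff_succ.1 hm₀
      rcases num_eq_zero_or_succ d with rfl | ⟨d, rfl⟩
      · simp at hd
      · have : (1 : M.Num) < 1 := (num_lt_iff _ _).2
          ⟨m * d + m * i + i * d + i + d + d + m + m * i * d, hd.trans (by ring)⟩
        exact lt_irrefl _ this
    · by_cases hb : b < k ∧ P b
      · refine ⟨n * (m * (b + 1) + 1), fun i hi => ?_⟩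
        by_cases hib : i = b
        · subst hib
          exact iff_of_true (dvd_mul_left _ _) ⟨num_lt_succ_self i, hb.2⟩
        · rw [num_lt_succ_iff, le_iff_lt_or_eq, or_iff_left hib, ← hn i hi]
          exact ⟨dvd_of_dvd_mul_modulus hm hi hb.1 hib, fun h => h.mul_right _⟩
      · refine ⟨n, fun i hi => ?_⟩
        rw [hn i hi, num_lt_succ_iff, le_iff_lt_or_eq]
        refine ⟨fun h => ⟨.inl h.1, h.2⟩, ?_⟩
        rintro ⟨h | rfl, h'⟩
        · exact ⟨h, h'⟩
        · exact absurd ⟨hi, h'⟩ hb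
  obtain ⟨n, hn⟩ := key k
  have hc : ∃ c, ∀ i, i < c + k → (FinMem i c ↔ i < k ∧ P i) := by
    refine ⟨pair k (pair m n), fun i _ => ?_⟩
    rw [finMem_pair]
    constructor
    · exact fun ⟨h₁, h₂⟩ => (hn i h₁).1 h₂
    · exact fun ⟨h₁, h₂⟩ => ⟨h₁, (hn i h₁).2 ⟨h₁, h₂⟩⟩
  have hfull : ∀ c, (∀ i, i < c + k → (FinMem i c ↔ i < k ∧ P i)) →
      ∀ i, FinMem i c ↔ i < k ∧ P i := fun c hc i => by
    rcases lt_or_ge i (c + k) with h | h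
    · exact hc i h
    · refine iff_of_false (fun h' => ?_) fun h' => ?_
      · exact (h'.lt.trans_le (le_self_add.trans h)).false
      · exact (h'.1.trans_le (le_add_self.trans h)).false
  obtain ⟨c, hc, hmin⟩ := D1.exists_least (P := fun c =>
    ∀ i, i < c + k → (FinMem i c ↔ i < k ∧ P i)) inferInstance hc
  refine ⟨c, fun c' hc' => ?_, hfull c hc⟩
  by_contra! h
  exact hmin c' hc' fun i _ => (h i).trans (hfull c hc i)

theorem IsFinCode.ext {c c' : M.Num} (hc : IsFinCode c) (hc' : IsFinCode c')
    (h : ∀ i, FinMem i c ↔ FinMem i c') : c = c' := by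
  rcases lt_trichotomy c c' with h' | h' | h'
  · obtain ⟨i, hi⟩ := hc' c h'; exact absurd (h i) hi
  · exact h'
  · obtain ⟨i, hi⟩ := hc c' h'; exact absurd (h i).symm hi

/-- Members of a code are smaller than the code, so the quantifier in `IsFinCode` is bounded. -/
theorem isFinCode_iff_bdd {c : M.Num} :
    IsFinCode c ↔ ∀ c', c' < c → ∃ i, i < c ∧ ¬ (FinMem i c' ↔ FinMem i c) := by
  refine forall₂_congr fun c' hc' => ⟨fun ⟨i, hi⟩ => ⟨i, ?_, hi⟩, fun ⟨i, _, hi⟩ => ⟨i, hi⟩⟩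
  by_contra h
  refine hi (iff_of_false (fun h' => ?_) fun h' => h h'.lt)
  exact h (h'.lt.trans hc')

instance D1.isFinCode {k : ℕ} {f : (Fin k → M.Num) → M.Num} [Comp f] :
    D1 (fun x => IsFinCode (f x)) :=
  D1.comp₁ (R := fun a => IsFinCode a) (by simp only [isFinCode_iff_bdd]; infer_instance)
    inferInstance

/-! ### Finite sequences -/

theorem pair_le_pair {i j i' j' : M.Num} (hi : i ≤ i') (hj : j ≤ j') : pair i j ≤ pair i' j' := by
  unfold pair; gcongr

theorem Entry.index_lt {σ i a : M.Num} (h : Entry σ i a) : i < σ :=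
  (left_le_pair i a).trans_lt h.lt

theorem Entry.value_lt {σ i a : M.Num} (h : Entry σ i a) : a < σ :=
  (right_le_pair i a).trans_lt h.lt

instance D1.entry {k : ℕ} {f g h : (Fin k → M.Num) → M.Num} [Comp f] [Comp g] [Comp h] :
    D1 (fun x => Entry (f x) (g x) (h x)) := by
  unfold Entry; infer_instance

theorem SeqLen.entry_lt {σ l i a : M.Num} (hσ : SeqLen σ l) (h : Entry σ i a) : i < l := by
  obtain ⟨i', a', hi, e⟩ := hσ.2.1 _ h
  rwa [(pair_inj.1 e).1]

omit hM in
theorem SeqLen.exists_entry {σ l i : M.Num} (hσ : SeqLen σ l) (hi : i < l) : ∃ a, Entry σ i a :=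
  (hσ.2.2 i hi).exists

theorem SeqLen.entry_unique {σ l i a b : M.Num} (hσ : SeqLen σ l) (ha : Entry σ i a)
    (hb : Entry σ i b) : a = b :=
  (hσ.2.2 i (hσ.entry_lt ha)).unique ha hb

theorem SeqLen.unique {σ l l' : M.Num} (h : SeqLen σ l) (h' : SeqLen σ l') : l = l' := by
  rcases lt_trichotomy l l' with hl | hl | hl
  · obtain ⟨a, ha⟩ := h'.exists_entry hl; exact absurd (h.entry_lt ha) (lt_irrefl _)
  · exact hl
  · obtain ⟨a, ha⟩ := h.exists_entry hl; exact absurd (h'.entry_lt ha) (lt_irrefl _)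

theorem SeqLen.le {σ l : M.Num} (h : SeqLen σ l) : l ≤ σ := by
  rcases num_eq_zero_or_succ l with rfl | ⟨l, rfl⟩
  · exact zero_le
  · obtain ⟨a, ha⟩ := h.exists_entry (num_lt_succ_self l)
    exact num_succ_le_iff.2 ha.index_lt

theorem SeqLen.ext {σ τ l : M.Num} (hσ : SeqLen σ l) (hτ : SeqLen τ l)
    (h : ∀ i, i < l → ∀ a, Entry σ i a → Entry τ i a) : σ = τ := by
  refine hσ.1.ext hτ.1 fun x => ⟨fun hx => ?_, fun hx => ?_⟩
  · obtain ⟨i, a, hi, rfl⟩ := hσ.2.1 x hx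
    exact h i hi a hx
  · obtain ⟨i, a, hi, rfl⟩ := hτ.2.1 x hx
    obtain ⟨b, hb⟩ := hσ.exists_entry hi
    rwa [hτ.entry_unique hx (h i hi b hb)]

theorem not_finMem_nil (i : M.Num) : ¬ FinMem i nil := fun h => hM.out.not_lt_zero _ h.lt

theorem seqLen_nil : SeqLen (nil : M.Num) 0 :=
  ⟨fun c' h => absurd h (hM.out.not_lt_zero c'), fun x hx => absurd hx (not_finMem_nil x),
    fun i h => absurd h (hM.out.not_lt_zero i)⟩

theorem seqLen_zero_iff {σ : M.Num} : SeqLen σ 0 ↔ σ = nil :=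
  ⟨fun h => h.ext seqLen_nil fun i hi => absurd hi (hM.out.not_lt_zero i),
    fun h => h ▸ seqLen_nil⟩

theorem seqLen_iff_bdd {σ l : M.Num} : SeqLen σ l ↔ IsFinCode σ ∧
    (∀ x, x < σ → (FinMem x σ → ∃ i, i < l ∧ ∃ a, a ≤ x ∧ x = pair i a)) ∧
    ∀ i, i < l → ∃ a, a < σ ∧ (Entry σ i a ∧ ∀ b, b < σ → (Entry σ i b → b = a)) := by
  refine and_congr Iff.rfl (and_congr ⟨fun h x _ hx => ?_, fun h x hx => ?_⟩
    (forall₂_congr fun i hi => ⟨fun ⟨a, h, ha⟩ => ?_, fun ⟨a, _, h, ha⟩ => ?_⟩))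
  · obtain ⟨i, a, hi, rfl⟩ := h x hx
    exact ⟨i, hi, a, right_le_pair _ _, rfl⟩
  · obtain ⟨i, hi, a, _, rfl⟩ := h x hx.lt hx
    exact ⟨i, a, hi, rfl⟩
  · exact ⟨a, Entry.value_lt h, h, fun b _ hb => ha b hb⟩
  · exact ⟨a, h, fun b hb => ha b (Entry.value_lt hb) hb⟩

instance D1.seqLen {k : ℕ} {f g : (Fin k → M.Num) → M.Num} [Comp f] [Comp g] :
    D1 (fun x => SeqLen (f x) (g x)) :=
  D1.comp₂ (R := fun a b => SeqLen a b) (by simp only [seqLen_iff_bdd]; infer_instance)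
    inferInstance inferInstance

theorem isSeq_iff_bdd {σ : M.Num} : IsSeq σ ↔ ∃ l, l ≤ σ ∧ SeqLen σ l :=
  ⟨fun ⟨l, h⟩ => ⟨l, h.le, h⟩, fun ⟨l, _, h⟩ => ⟨l, h⟩⟩

instance D1.isSeq {k : ℕ} {f : (Fin k → M.Num) → M.Num} [Comp f] : D1 (fun x => IsSeq (f x)) :=
  D1.comp₁ (R := fun a => IsSeq a) (by simp only [isSeq_iff_bdd]; infer_instance) inferInstance

/-- A finite sequence may be defined by a `Δ⁰₁` condition on its entries, if these are bounded. -/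
theorem D1.exists_seqLen {E : M.Num → M.Num → Prop}
    (hE : D1 (fun x : Fin 2 → M.Num => E (x 0) (x 1))) (l b : M.Num)
    (h : ∀ i, i < l → ∃ a, a ≤ b ∧ E i a ∧ ∀ a', E i a' → a' = a) :
    ∃ σ, SeqLen σ l ∧ ∀ i, i < l → ∀ a, Entry σ i a ↔ E i a := by
  have {k : ℕ} {f g : (Fin k → M.Num) → M.Num} [Comp f] [Comp g] : D1 (fun x => E (f x) (g x)) :=
    D1.comp₂ hE inferInstance inferInstance
  obtain ⟨σ, hσ, hmem⟩ := D1.exists_finCode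
    (P := fun x => ∃ i, i < l ∧ ∃ a, a ≤ b ∧ (x = pair i a ∧ E i a)) inferInstance (pair l b + 1)
  have key : ∀ i, i < l → ∀ a, Entry σ i a ↔ E i a := fun i hi a => by
    refine (hmem _).trans ⟨?_, fun ha => ?_⟩
    · rintro ⟨_, i', _, a', _, e, h'⟩
      rwa [(pair_inj.1 e).1, (pair_inj.1 e).2]
    · obtain ⟨a', ha', h₁, h₂⟩ := h i hi
      obtain rfl := h₂ a ha
      exact ⟨num_lt_succ_iff.2 (pair_le_pair hi.le ha'), i, hi, a, ha', rfl, ha⟩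
  refine ⟨σ, ⟨hσ, fun x hx => ?_, fun i hi => ?_⟩, key⟩
  · obtain ⟨_, i, hi, a, _, e, _⟩ := (hmem x).1 hx
    exact ⟨i, a, hi, e⟩
  · obtain ⟨a, _, h₁, h₂⟩ := h i hi
    exact ⟨a, (key i hi a).2 h₁, fun a' ha' => h₂ a' ((key i hi a').1 ha')⟩

/-! ### Initial segments and extensions of sequences -/

theorem forall_entry_iff_bdd {σ τ i j : M.Num} : (∀ a, Entry σ i a ↔ Entry τ j a) ↔
    ∀ a, a < σ + τ → (Entry σ i a ↔ Entry τ j a) := by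
  refine ⟨fun h a _ => h a, fun h a => ⟨fun ha => ?_, fun ha => ?_⟩⟩
  · exact (h a (ha.value_lt.trans_le le_self_add)).1 ha
  · exact (h a (ha.value_lt.trans_le le_add_self)).2 ha

theorem append_iff_bdd {σ n τ : M.Num} : Append σ n τ ↔ ∃ l, l ≤ σ ∧ (SeqLen σ l ∧
    SeqLen τ (l + 1) ∧
    (∀ i, i < l → ∀ a, a < τ + σ → (Entry τ i a ↔ Entry σ i a)) ∧ Entry τ l n) := by
  simp only [← forall_entry_iff_bdd]
  exact ⟨fun ⟨l, h⟩ => ⟨l, h.1.le, h⟩, fun ⟨l, _, h⟩ => ⟨l, h⟩⟩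

theorem prepend_iff_bdd {k σ τ : M.Num} : Prepend k σ τ ↔ ∃ l, l ≤ σ ∧ (SeqLen σ l ∧
    SeqLen τ (l + 1) ∧ Entry τ 0 k ∧
    ∀ i, i < l → ∀ a, a < τ + σ → (Entry τ (i + 1) a ↔ Entry σ i a)) := by
  simp only [← forall_entry_iff_bdd]
  exact ⟨fun ⟨l, h⟩ => ⟨l, h.1.le, h⟩, fun ⟨l, _, h⟩ => ⟨l, h⟩⟩

theorem prefix_iff_bdd {σ τ : M.Num} : Prefix σ τ ↔ ∃ l, l ≤ σ ∧ ∃ l', l' ≤ τ ∧ (SeqLen σ l ∧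
    SeqLen τ l' ∧ l ≤ l' ∧ ∀ i, i < l → ∀ a, a < σ + τ → (Entry σ i a ↔ Entry τ i a)) := by
  simp only [← forall_entry_iff_bdd]
  exact ⟨fun ⟨l, l', h⟩ => ⟨l, h.1.le, l', h.2.1.le, h⟩, fun ⟨l, _, l', _, h⟩ => ⟨l, l', h⟩⟩

section instances

variable {k : ℕ} {f g h : (Fin k → M.Num) → M.Num} [Comp f] [Comp g] [Comp h]

instance D1.append : D1 (fun x => Append (f x) (g x) (h x)) :=
  D1.comp₃ (R := fun a b c => Append a b c) (by simp only [append_iff_bdd]; infer_instance)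
    inferInstance inferInstance inferInstance

instance D1.prepend : D1 (fun x => Prepend (f x) (g x) (h x)) :=
  D1.comp₃ (R := fun a b c => Prepend a b c) (by simp only [prepend_iff_bdd]; infer_instance)
    inferInstance inferInstance inferInstance

instance D1.prefix : D1 (fun x => Prefix (f x) (g x)) :=
  D1.comp₂ (R := fun a b => Prefix a b) (by simp only [prefix_iff_bdd]; infer_instance)
    inferInstance inferInstance

end instances

theorem SeqLen.prefix_iff {σ τ l l' : M.Num} (hσ : SeqLen σ l) (hτ : SeqLen τ l') :
    Prefix σ τ ↔ l ≤ l' ∧ ∀ i a, Entry σ i a → Entry τ i a := by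
  constructor
  · rintro ⟨m, m', hm, hm', hle, h⟩
    obtain rfl := hσ.unique hm
    obtain rfl := hτ.unique hm'
    exact ⟨hle, fun i a ha => (h i (hσ.entry_lt ha) a).1 ha⟩
  · rintro ⟨hle, h⟩
    refine ⟨l, l', hσ, hτ, hle, fun i hi a => ⟨h i a, fun ha => ?_⟩⟩
    obtain ⟨b, hb⟩ := hσ.exists_entry hi
    rwa [hτ.entry_unique ha (h i b hb)]

theorem Prefix.exists_len {σ τ : M.Num} (h : Prefix σ τ) :
    ∃ l l', SeqLen σ l ∧ SeqLen τ l' ∧ l ≤ l' ∧ ∀ i a, Entry σ i a → Entry τ i a := by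
  obtain ⟨l, l', h₁, h₂, _⟩ := id h
  exact ⟨l, l', h₁, h₂, (h₁.prefix_iff h₂).1 h⟩

theorem IsSeq.prefix_refl {σ : M.Num} (h : IsSeq σ) : Prefix σ σ := by
  obtain ⟨l, hl⟩ := h
  exact (hl.prefix_iff hl).2 ⟨le_rfl, fun _ _ => id⟩

theorem IsSeq.nil_prefix {σ : M.Num} (h : IsSeq σ) : Prefix nil σ := by
  obtain ⟨l, hl⟩ := h
  exact (seqLen_nil.prefix_iff hl).2 ⟨zero_le, fun _ _ h => absurd h (not_finMem_nil _)⟩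

theorem Prefix.trans {σ τ ρ : M.Num} (h₁ : Prefix σ τ) (h₂ : Prefix τ ρ) : Prefix σ ρ := by
  obtain ⟨l, l', hσ, hτ, hle, h⟩ := h₁.exists_len
  obtain ⟨m, m', hτ', hρ, hle', h'⟩ := h₂.exists_len
  obtain rfl := hτ.unique hτ'
  exact (hσ.prefix_iff hρ).2 ⟨hle.trans hle', fun i a ha => h' i a (h i a ha)⟩

theorem Prefix.eq_of_len_le {σ τ l l' : M.Num} (h : Prefix σ τ) (hσ : SeqLen σ l)
    (hτ : SeqLen τ l') (hle : l' ≤ l) : σ = τ := by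
  have := (hσ.prefix_iff hτ).1 h
  obtain rfl := le_antisymm hle this.1
  exact hσ.ext hτ fun i _ a => this.2 i a

theorem Prefix.antisymm {σ τ : M.Num} (h₁ : Prefix σ τ) (h₂ : Prefix τ σ) : σ = τ := by
  obtain ⟨l, l', hσ, hτ, -, -⟩ := h₁.exists_len
  exact h₁.eq_of_len_le hσ hτ ((hτ.prefix_iff hσ).1 h₂).1

/-- The initial segments of a sequence are ordered by their lengths. -/
theorem Prefix.prefix_of_len_le {σ τ ρ l l' : M.Num} (h₁ : Prefix σ ρ) (h₂ : Prefix τ ρ)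
    (hσ : SeqLen σ l) (hτ : SeqLen τ l') (hle : l ≤ l') : Prefix σ τ := by
  obtain ⟨_, m, _, hρ, -, h⟩ := h₁.exists_len
  refine (hσ.prefix_iff hτ).2 ⟨hle, fun i a ha => ?_⟩
  obtain ⟨b, hb⟩ := hτ.exists_entry ((hσ.entry_lt ha).trans_le hle)
  rwa [hρ.entry_unique (h i a ha) (((hτ.prefix_iff hρ).1 h₂).2 i b hb)]

theorem SeqLen.exists_restrict {σ l l' : M.Num} (hσ : SeqLen σ l) (hle : l' ≤ l) :
    ∃ ρ, SeqLen ρ l' ∧ Prefix ρ σ := by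
  obtain ⟨ρ, hρ, h⟩ := D1.exists_seqLen (E := fun i a => Entry σ i a) inferInstance l' σ
    fun i hi => by
      obtain ⟨a, ha⟩ := hσ.exists_entry (hi.trans_le hle)
      exact ⟨a, ha.value_lt.le, ha, fun b hb => hσ.entry_unique hb ha⟩
  exact ⟨ρ, hρ, (hρ.prefix_iff hσ).2 ⟨hle, fun i a ha => (h i (hρ.entry_lt ha) a).1 ha⟩⟩

theorem SeqLen.append_iff {σ n τ l : M.Num} (hσ : SeqLen σ l) :
    Append σ n τ ↔ SeqLen τ (l + 1) ∧ Prefix σ τ ∧ Entry τ l n := by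
  constructor
  · rintro ⟨m, hm, hτ, h, hn⟩
    obtain rfl := hσ.unique hm
    exact ⟨hτ, (hσ.prefix_iff hτ).2 ⟨le_self_add, fun i a ha => (h i (hσ.entry_lt ha) a).2 ha⟩, hn⟩
  · rintro ⟨hτ, ⟨m, m', hm, hm', _, h⟩, hn⟩
    obtain rfl := hσ.unique hm
    exact ⟨l, hσ, hτ, fun i hi a => (h i hi a).symm, hn⟩

theorem SeqLen.exists_append_iff {σ τ l : M.Num} (hσ : SeqLen σ l) :
    (∃ n, Append σ n τ) ↔ SeqLen τ (l + 1) ∧ Prefix σ τ := by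
  simp only [hσ.append_iff]
  refine ⟨fun ⟨n, h₁, h₂, _⟩ => ⟨h₁, h₂⟩, fun ⟨h₁, h₂⟩ => ?_⟩
  obtain ⟨n, hn⟩ := h₁.exists_entry (num_lt_succ_self l)
  exact ⟨n, h₁, h₂, hn⟩

omit hM in
theorem Append.isSeq {σ n τ : M.Num} (h : Append σ n τ) : IsSeq σ := by
  obtain ⟨l, hl, -⟩ := h; exact ⟨l, hl⟩

theorem Append.prefix {σ n τ : M.Num} (h : Append σ n τ) : Prefix σ τ := by
  obtain ⟨l, hl⟩ := h.isSeq; exact (hl.append_iff.1 h).2.1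

theorem Append.value_lt {σ n τ : M.Num} (h : Append σ n τ) : n < τ := by
  obtain ⟨l, hl⟩ := h.isSeq; exact (hl.append_iff.1 h).2.2.value_lt

/-! ### Adding a first entry -/

theorem exists_prepend (k : M.Num) {σ : M.Num} (h : IsSeq σ) : ∃ τ, Prepend k σ τ := by
  obtain ⟨l, hl⟩ := h
  obtain ⟨τ, hτ, h⟩ := D1.exists_seqLen
    (E := fun i a => (i = 0 ∧ a = k) ∨ ∃ j, j < i ∧ (i = j + 1 ∧ Entry σ j a)) inferInstance
    (l + 1) (k + σ) fun i hi => by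
      rcases num_eq_zero_or_succ i with rfl | ⟨i, rfl⟩
      · refine ⟨k, le_self_add, .inl ⟨rfl, rfl⟩, ?_⟩
        rintro a (⟨_, h⟩ | ⟨j, hj, _⟩)
        · exact h
        · exact absurd hj (hM.out.not_lt_zero j)
      · obtain ⟨a, ha⟩ := hl.exists_entry (lt_of_add_lt_add_right hi)
        refine ⟨a, ha.value_lt.le.trans le_add_self,
          .inr ⟨i, num_lt_succ_self i, rfl, ha⟩, ?_⟩
        rintro b (⟨h, _⟩ | ⟨j, _, hj, hb⟩)
        · exact absurd h (hM.out.succ_ne_zero i)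
        · obtain rfl := add_right_cancel hj
          exact hl.entry_unique hb ha
  refine ⟨τ, l, hl, hτ, (h 0 (num_pos_iff_succ.2 ⟨l, rfl⟩) k).2 (.inl ⟨rfl, rfl⟩),
    fun i hi a => (h (i + 1) (by gcongr) a).trans ⟨?_, fun ha => ?_⟩⟩
  · rintro (⟨h, _⟩ | ⟨j, _, hj, hb⟩)
    · exact absurd h (hM.out.succ_ne_zero i)
    · rwa [add_right_cancel hj]
  · exact .inr ⟨i, num_lt_succ_self i, rfl, ha⟩

theorem SeqLen.exists_prepend_eq {τ l : M.Num} (hτ : SeqLen τ (l + 1)) :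
    ∃ k σ, SeqLen σ l ∧ Prepend k σ τ := by
  obtain ⟨k, hk⟩ := hτ.exists_entry (num_pos_iff_succ.2 ⟨l, rfl⟩)
  obtain ⟨σ, hσ, h⟩ := D1.exists_seqLen (E := fun i a => Entry τ (i + 1) a) inferInstance l τ
    fun i hi => by
      obtain ⟨a, ha⟩ := hτ.exists_entry (i := i + 1) (by gcongr)
      exact ⟨a, ha.value_lt.le, ha, fun b hb => hτ.entry_unique hb ha⟩
  exact ⟨k, σ, hσ, l, hσ, hτ, hk, fun i hi a => (h i hi a).symm⟩

theorem IsSeq.eq_nil_or_prepend {τ : M.Num} (h : IsSeq τ) : τ = nil ∨ ∃ k σ, Prepend k σ τ := by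
  obtain ⟨l, hl⟩ := h
  rcases num_eq_zero_or_succ l with rfl | ⟨l, rfl⟩
  · exact .inl (seqLen_zero_iff.1 hl)
  · obtain ⟨k, σ, -, h⟩ := hl.exists_prepend_eq
    exact .inr ⟨k, σ, h⟩

omit hM in
theorem Prepend.isSeq {k σ τ : M.Num} (h : Prepend k σ τ) : IsSeq σ := by
  obtain ⟨l, hl, -⟩ := h; exact ⟨l, hl⟩

omit hM in
theorem Prepend.isSeq' {k σ τ : M.Num} (h : Prepend k σ τ) : IsSeq τ := by
  obtain ⟨l, -, hl, -⟩ := h; exact ⟨_, hl⟩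

theorem Prepend.ne_nil {k σ τ : M.Num} (h : Prepend k σ τ) : τ ≠ nil := by
  rintro rfl
  obtain ⟨l, -, -, h, -⟩ := h
  exact not_finMem_nil _ h

omit hM in
theorem Prepend.entry_zero {k σ τ : M.Num} (h : Prepend k σ τ) : Entry τ 0 k := by
  obtain ⟨l, -, -, h, -⟩ := h; exact h

theorem Prepend.entry_succ {k σ τ : M.Num} (h : Prepend k σ τ) {i a : M.Num} :
    Entry τ (i + 1) a ↔ Entry σ i a := by
  obtain ⟨l, hσ, hτ, -, h⟩ := h
  refine ⟨fun ha => ?_, fun ha => (h i (hσ.entry_lt ha) a).2 ha⟩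
  exact (h i (lt_of_add_lt_add_right (hτ.entry_lt ha)) a).1 ha

theorem Prepend.seqLen_iff {k σ τ l : M.Num} (h : Prepend k σ τ) :
    SeqLen τ (l + 1) ↔ SeqLen σ l := by
  obtain ⟨m, hσ, hτ, -, -⟩ := h
  refine ⟨fun h' => ?_, fun h' => ?_⟩
  · rwa [add_right_cancel (h'.unique hτ)]
  · rwa [h'.unique hσ]

theorem Prepend.unique {k σ τ τ' : M.Num} (h : Prepend k σ τ) (h' : Prepend k σ τ') : τ = τ' := by
  obtain ⟨l, hl⟩ := h.isSeq
  refine (h.seqLen_iff.2 hl).ext (h'.seqLen_iff.2 hl) fun i _ a ha => ?_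
  rcases num_eq_zero_or_succ i with rfl | ⟨i, rfl⟩
  · rw [(h.seqLen_iff.2 hl).entry_unique ha h.entry_zero]; exact h'.entry_zero
  · exact h'.entry_succ.2 (h.entry_succ.1 ha)

theorem Prepend.inj {k k' σ σ' τ : M.Num} (h : Prepend k σ τ) (h' : Prepend k' σ' τ) :
    k = k' ∧ σ = σ' := by
  obtain ⟨l, hl⟩ := h.isSeq
  have hτ := h.seqLen_iff.2 hl
  exact ⟨hτ.entry_unique h.entry_zero h'.entry_zero,
    hl.ext (h'.seqLen_iff.1 hτ) fun i _ a ha => h'.entry_succ.1 (h.entry_succ.2 ha)⟩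

theorem Prepend.prefix_iff {k σ σ' τ τ' : M.Num} (h : Prepend k σ τ) (h' : Prepend k σ' τ') :
    Prefix τ τ' ↔ Prefix σ σ' := by
  obtain ⟨l, hl⟩ := h.isSeq
  obtain ⟨l', hl'⟩ := h'.isSeq
  have hτ := h.seqLen_iff.2 hl
  have hτ' := h'.seqLen_iff.2 hl'
  rw [hl.prefix_iff hl', hτ.prefix_iff hτ', add_le_add_iff_right]
  refine and_congr_right fun _ => ⟨fun H i a ha => ?_, fun H i a ha => ?_⟩
  · exact h'.entry_succ.1 (H _ _ (h.entry_succ.2 ha))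
  · rcases num_eq_zero_or_succ i with rfl | ⟨i, rfl⟩
    · rw [hτ.entry_unique ha h.entry_zero]; exact h'.entry_zero
    · exact h'.entry_succ.2 (H _ _ (h.entry_succ.1 ha))

theorem Prepend.exists_append_iff {k σ σ' τ τ' : M.Num} (h : Prepend k σ τ)
    (h' : Prepend k σ' τ') : (∃ n, Append τ n τ') ↔ ∃ n, Append σ n σ' := by
  obtain ⟨l, hl⟩ := h.isSeq
  rw [hl.exists_append_iff, (h.seqLen_iff.2 hl).exists_append_iff, h'.seqLen_iff, h.prefix_iff h']

/-- An extension of `⟨k⟩⌢σ` is of the form `⟨k⟩⌢σ'`. -/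
theorem Prepend.of_prefix {k k' σ σ' τ τ' : M.Num} (h : Prepend k σ τ) (h' : Prepend k' σ' τ')
    (hp : Prefix τ τ') : k = k' := by
  obtain ⟨_, l', _, hl', -, H⟩ := hp.exists_len
  exact hl'.entry_unique (H _ _ h.entry_zero) h'.entry_zero

/-- A condition on the first entry and the remaining sequence of `f x` is `Δ⁰₁`. A bound on the code
of the remaining sequence is not needed, since this sequence is unique. -/
instance D1.exists_prepend_eq {k : ℕ} {R : (Fin k → M.Num) → M.Num → M.Num → Prop}
    {f : (Fin k → M.Num) → M.Num} [hf : Comp f] [hR : D1 (fun z : Fin (k + 2) → M.Num =>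
      R (fun i => z i.succ.succ) (z (Fin.succ 0)) (z 0))] :
    D1 (fun x => ∃ a b, R x a b ∧ Prepend a b (f x)) := by
  have : Comp (fun z : Fin (k + 2) → M.Num => f fun i => z i.succ.succ) :=
    hf.reindex fun i => i.succ.succ
  have := hR.pos
  refine ⟨inferInstance, S1.congr (P := fun x => ¬ (IsSeq (f x) ∧ f x ≠ nil) ∨
    ∃ a b, ¬ R x a b ∧ Prepend a b (f x)) inferInstance fun x => ?_⟩
  constructor
  · intro h
    by_cases h' : IsSeq (f x) ∧ f x ≠ nil
    · obtain ⟨a, b, hab⟩ := h'.1.eq_nil_or_prepend.resolve_left h'.2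
      exact .inr ⟨a, b, fun hR => h ⟨a, b, hR, hab⟩, hab⟩
    · exact .inl h'
  · rintro (h | ⟨a, b, hR, hab⟩) ⟨a', b', hR', hab'⟩
    · exact h ⟨hab'.isSeq', hab'.ne_nil⟩
    · obtain ⟨rfl, rfl⟩ := hab.inj hab'
      exact hR hR'

/-- A condition on the sequence `⟨f x⟩⌢g x` is `Δ⁰₁`, again because this sequence is unique. -/
instance D1.exists_prepend {k : ℕ} {R : (Fin k → M.Num) → M.Num → Prop}
    {f g : (Fin k → M.Num) → M.Num} [hf : Comp f] [hg : Comp g]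
    [hR : D1 (fun z : Fin (k + 1) → M.Num => R (fun i => z i.succ) (z 0))] :
    D1 (fun x => ∃ τ, Prepend (f x) (g x) τ ∧ R x τ) := by
  have := hf.reindex Fin.succ
  have := hg.reindex Fin.succ
  have := hR.pos
  refine ⟨inferInstance, S1.congr (P := fun x => ¬ IsSeq (g x) ∨
    ∃ τ, Prepend (f x) (g x) τ ∧ ¬ R x τ) inferInstance fun x => ?_⟩
  constructor
  · intro h
    by_cases h' : IsSeq (g x)
    · obtain ⟨τ, hτ⟩ := L2Structure.exists_prepend (f x) h'
      exact .inr ⟨τ, hτ, fun hR => h ⟨τ, hτ, hR⟩⟩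
    · exact .inl h'
  · rintro (h | ⟨τ, hτ, hR⟩) ⟨τ', hτ', hR'⟩
    · exact h hτ'.isSeq
    · exact hR (hτ.unique hτ' ▸ hR')

/-! ### Primitive recursion and paths -/

/-- Minimization. -/
theorem D1.exists_comp {R : M.Num → M.Num → Prop}
    (hR : D1 (fun x : Fin 2 → M.Num => R (x 0) (x 1))) (h : ∀ x, ∃ y, R x y) :
    ∃ g : M.Num → M.Num, Comp (fun x : Fin 1 → M.Num => g (x 0)) ∧ ∀ x, R x (g x) := by
  have {k : ℕ} {f g : (Fin k → M.Num) → M.Num} [Comp f] [Comp g] : D1 (fun x => R (f x) (g x)) :=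
    D1.comp₂ hR inferInstance inferInstance
  choose g hg hmin using fun x => D1.exists_least (P := fun y => R x y) inferInstance (h x)
  refine ⟨g, ⟨S1.congr (P := fun z : Fin 2 → M.Num => R (z 1) (z 0) ∧ ∀ y, y < z 0 → ¬ R (z 1) y)
    inferInstance fun z => ?_⟩, hg⟩
  change z 0 = g (z 1) ↔ _
  refine ⟨fun h => h ▸ ⟨hg _, hmin _⟩, fun ⟨h₁, h₂⟩ => ?_⟩
  rcases lt_trichotomy (z 0) (g (z 1)) with h | h | h
  · exact absurd h₁ (hmin _ _ h)
  · exact h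
  · exact absurd (hg _) (h₂ _ h)

/-- Iteration: the values `h^[i] a` for `i ≤ n` are found in a code of a finite set. -/
theorem Comp.exists_iterate {h : M.Num → M.Num} (hh : Comp (fun x : Fin 1 → M.Num => h (x 0)))
    (a : M.Num) : ∃ g : M.Num → M.Num, Comp (fun x : Fin 1 → M.Num => g (x 0)) ∧ g 0 = a ∧
      ∀ n, g (n + 1) = h (g n) := by
  have {k : ℕ} {f : (Fin k → M.Num) → M.Num} [Comp f] : Comp (fun x => h (f x)) :=
    Comp.comp₁ hh inferInstance
  -- `OK c n`: the code `c` is the graph of a partial function whose values at the `i ≤ n` are those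
  -- of the iteration. The bounds on `i` and `z` hold automatically and serve to make this `Δ⁰₁`.
  let OK : M.Num → M.Num → Prop := fun c n => FinMem (pair 0 a) c ∧
    (∀ i, i < n → ∀ z, z < c → (FinMem (pair i z) c → FinMem (pair (i + 1) (h z)) c)) ∧
    ∀ i, i < c → ∀ z, z < c → ∀ z', z' < c →
      (FinMem (pair i z) c → FinMem (pair i z') c → z = z')
  have hOK {k : ℕ} {f g : (Fin k → M.Num) → M.Num} [Comp f] [Comp g] :
      D1 (fun x => OK (f x) (g x)) :=
    D1.comp₂ (R := OK) inferInstance inferInstance inferInstance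
  have vlt {i z c : M.Num} (hz : FinMem (pair i z) c) : z < c := (right_le_pair _ _).trans_lt hz.lt
  have ilt {i z c : M.Num} (hz : FinMem (pair i z) c) : i < c := (left_le_pair _ _).trans_lt hz.lt
  have huniq {c n i z z' : M.Num} (hc : OK c n) (hz : FinMem (pair i z) c)
      (hz' : FinMem (pair i z') c) : z = z' := hc.2.2 i (ilt hz) z (vlt hz) z' (vlt hz') hz hz'
  have agree {c c' n n' : M.Num} (hc : OK c n) (hc' : OK c' n') (i : M.Num) (hi : i ≤ n)
      (hi' : i ≤ n') : ∃ z, z < c ∧ (FinMem (pair i z) c ∧ FinMem (pair i z) c') := by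
    refine D1.induction (P := fun i => i ≤ n → i ≤ n' →
      ∃ z, z < c ∧ (FinMem (pair i z) c ∧ FinMem (pair i z) c')) inferInstance
      (fun _ _ => ⟨a, vlt hc.1, hc.1, hc'.1⟩) (fun i ih hi hi' => ?_) i hi hi'
    rw [num_succ_le_iff] at hi hi'
    obtain ⟨z, hz, h₁, h₂⟩ := ih hi.le hi'.le
    have h₃ := hc.2.1 i hi z hz h₁
    exact ⟨h z, vlt h₃, h₃, hc'.2.1 i hi' z (vlt h₂) h₂⟩
  have hex : ∀ n, ∃ c, OK c n := by
    refine S1.induction inferInstance ?_ ?_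
    · obtain ⟨c, _, hc⟩ := D1.exists_finCode (P := fun x => x = pair 0 a) inferInstance
        (pair 0 a + 1)
      refine ⟨c, (hc _).2 ⟨num_lt_succ_self _, rfl⟩,
        fun i hi => absurd hi (hM.out.not_lt_zero i), ?_⟩
      intro i _ z _ z' _ hz hz'
      rw [hc, pair_inj] at hz hz'
      exact hz.2.2.trans hz'.2.2.symm
    · rintro n ⟨c, hc⟩
      obtain ⟨z, -, hz, -⟩ := agree hc hc n le_rfl le_rfl
      -- Members of `c` with an index above `n` are dropped before the new value is put in.
      obtain ⟨c', _, hc'⟩ := D1.exists_finCode (P := fun x =>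
        (FinMem x c ∧ ∃ i, i ≤ n ∧ ∃ z, z ≤ x ∧ x = pair i z) ∨ x = pair (n + 1) (h z))
        inferInstance (c + pair (n + 1) (h z) + 1)
      have key : ∀ i w, FinMem (pair i w) c' ↔
          (i ≤ n ∧ FinMem (pair i w) c) ∨ (i = n + 1 ∧ w = h z) := fun i w => by
        rw [hc', ← pair_inj]
        constructor
        · rintro ⟨_, ⟨h₁, i', hi', w', _, e⟩ | h₁⟩
          · obtain ⟨rfl, rfl⟩ := pair_inj.1 e
            exact .inl ⟨hi', h₁⟩
          · exact .inr h₁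
        · rintro (⟨h₁, h₂⟩ | h₁)
          · exact ⟨h₂.lt.trans_le (by rw [add_assoc]; exact le_self_add),
              .inl ⟨h₂, i, h₁, w, right_le_pair _ _, rfl⟩⟩
          · exact ⟨num_lt_succ_iff.2 (h₁ ▸ le_add_self), .inr h₁⟩
      refine ⟨c', (key _ _).2 (.inl ⟨zero_le, hc.1⟩), fun i hi w _ hw => ?_, ?_⟩
      · rw [num_lt_succ_iff] at hi
        rcases (key i w).1 hw with ⟨_, hw⟩ | ⟨rfl, _⟩
        · rcases hi.lt_or_eq with hi | rfl
          · exact (key _ _).2 (.inl ⟨num_succ_le_iff.2 hi, hc.2.1 i hi w (vlt hw) hw⟩)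
          · exact (key _ _).2 (.inr ⟨rfl, by rw [huniq hc hw hz]⟩)
        · exact absurd hi (not_le.2 (num_lt_succ_self n))
      · intro i _ w _ w' _ hw hw'
        rcases (key i w).1 hw with ⟨h₁, h₂⟩ | ⟨rfl, h₂⟩ <;>
          rcases (key _ w').1 hw' with ⟨h₃, h₄⟩ | ⟨h₃, h₄⟩
        · exact huniq hc h₂ h₄
        · exact absurd (h₃ ▸ h₁) (not_le.2 (num_lt_succ_self n))
        · exact absurd h₃ (not_le.2 (num_lt_succ_self n))
        · rw [h₂, h₄]
  choose c hc using hex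
  choose g _ hg using fun n => agree (hc n) (hc n) n le_rfl le_rfl
  have hg_iff : ∀ n y, y = g n ↔ ∃ c, OK c n ∧ FinMem (pair n y) c := fun n y => by
    constructor
    · rintro rfl; exact ⟨c n, hc n, (hg n).1⟩
    · rintro ⟨c', hc', hy⟩
      obtain ⟨z, _, h₁, h₂⟩ := agree (hc n) hc' n le_rfl le_rfl
      rw [huniq hc' hy h₂, huniq (hc n) h₁ (hg n).1]
  refine ⟨g, ⟨S1.congr
    (P := fun z : Fin 2 → M.Num => ∃ c, OK c (z 1) ∧ FinMem (pair (z 1) (z 0)) c) inferInstance fun z => hg_iff _ _⟩, ?_, fun n => ?_⟩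
  · exact ((hg_iff 0 a).2 ⟨c 0, hc 0, (hc 0).1⟩).symm
  · refine ((hg_iff _ _).2 ⟨c (n + 1), hc (n + 1), ?_⟩).symm
    obtain ⟨z, _, h₁, h₂⟩ := agree (hc n) (hc (n + 1)) n le_rfl le_self_add
    rw [huniq (hc n) (hg n).1 h₁]
    exact (hc (n + 1)).2.1 n (num_lt_succ_self n) z (vlt h₂) h₂

/-- A set of sequences which contains the empty one, and with each of its members an extension by
one entry, has a path. -/
theorem exists_path {D : Set M.Num} (hD : D ∈ M.Sets) (hnil : nil ∈ D)
    (hext : ∀ σ ∈ D, ∃ τ ∈ D, ∃ n, Append σ n τ) : ∃ G ∈ M.Sets, IsPath D G := by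
  have := Fact.mk hD
  obtain ⟨h, hh, hstep⟩ := D1.exists_comp
    (R := fun σ τ => σ ∈ D → τ ∈ D ∧ ∃ n, n ≤ τ ∧ Append σ n τ) inferInstance fun σ => by
      by_cases hσ : σ ∈ D
      · obtain ⟨τ, hτ, n, hn⟩ := hext σ hσ
        exact ⟨τ, fun _ => ⟨hτ, n, hn.value_lt.le, hn⟩⟩
      · exact ⟨0, fun h => absurd h hσ⟩
  obtain ⟨g, hg, hg₀, hg₁⟩ := hh.exists_iterate nil
  have {k : ℕ} {f : (Fin k → M.Num) → M.Num} [Comp f] : Comp (fun x => g (f x)) :=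
    Comp.comp₁ hg inferInstance
  have hgD : ∀ n, g n ∈ D ∧ SeqLen (g n) n := by
    refine D1.induction inferInstance (hg₀ ▸ ⟨hnil, seqLen_nil⟩) fun n ⟨h₁, h₂⟩ => ?_
    obtain ⟨h₃, m, _, h₄⟩ := hstep _ h₁
    rw [hg₁]
    exact ⟨h₃, (h₂.append_iff.1 h₄).1⟩
  have hpre : ∀ n, ∀ i, i < n → Prefix (g (i + 1)) (g n) := by
    refine D1.induction inferInstance (fun i hi => absurd hi (hM.out.not_lt_zero i)) ?_
    intro n ih i hi
    rcases (num_lt_succ_iff.1 hi).lt_or_eq with hi | rfl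
    · obtain ⟨-, m, _, h₄⟩ := hstep _ (hgD n).1
      refine (ih i hi).trans ?_
      rw [hg₁ n]
      exact h₄.prefix
    · exact IsSeq.prefix_refl ⟨_, (hgD _).2⟩
  refine ⟨_, D1.setOf_mem (P := fun x => ∃ i, i ≤ x ∧ ∃ a, a ≤ x ∧
    (x = pair i a ∧ Entry (g (i + 1)) i a)) inferInstance, ⟨?_, fun i _ => ?_⟩, fun n => ?_⟩
  · rintro _ ⟨i, _, a, _, rfl, _⟩
    exact ⟨i, trivial, a, rfl⟩
  · obtain ⟨a, ha⟩ := (hgD (i + 1)).2.exists_entry (num_lt_succ_self i)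
    refine ⟨a, ⟨i, left_le_pair _ _, a, right_le_pair _ _, rfl, ha⟩, ?_⟩
    rintro b ⟨i', _, b', _, e, hb⟩
    obtain ⟨rfl, rfl⟩ := pair_inj.1 e
    exact (hgD _).2.entry_unique hb ha
  · refine ⟨g n, (hgD n).1, (hgD n).2, fun i hi a ha =>
      ⟨i, left_le_pair _ _, a, right_le_pair _ _, rfl, ?_⟩⟩
    obtain ⟨b, hb⟩ := (hgD (i + 1)).2.exists_entry (num_lt_succ_self i)
    have := (((hgD (i + 1)).2.prefix_iff (hgD n).2).1 (hpre n i hi)).2 i b hb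
    rwa [(hgD n).2.entry_unique ha this]

/-! ### Evaluation maps -/

/-- The condition which the definition of an evaluation map imposes at the node `σ`, for an
assignment of truth values given as a predicate `V`. -/
def EvalAt (leafTrue : M.Num → Prop) (T L : Set M.Num) (V : M.Num → Prop) (σ : M.Num) : Prop :=
  (∀ c, pair σ (c + 1 + 1) ∈ L → (V σ ↔ leafTrue c)) ∧
    (pair σ 0 ∈ L → (V σ ↔ ∃ τ, Child T σ τ ∧ V τ)) ∧
    (pair σ 1 ∈ L → (V σ ↔ ∀ τ, Child T σ τ → V τ))

omit hM in
theorem IsEval.evalAt {leafTrue : M.Num → Prop} {T L F : Set M.Num} (hF : IsEval leafTrue T L F)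
    {σ : M.Num} (hσ : σ ∈ T) : EvalAt leafTrue T L (fun τ => pair τ 1 ∈ F) σ :=
  hF.2.2 σ hσ

theorem sec_mem {Z : Set M.Num} (hZ : Z ∈ M.Sets) (k : M.Num) : sec Z k ∈ M.Sets := by
  have := Fact.mk hZ
  exact D1.setOf_mem (P := fun n => pair k n ∈ Z) inferInstance

/-- A `Δ⁰₁` assignment of truth values which is correct at each node is an evaluation map. -/
theorem D1.exists_isEval {leafTrue : M.Num → Prop} {T L : Set M.Num} (hT : T ∈ M.Sets)
    {V : M.Num → Prop} (hV : D1 (fun x : Fin 1 → M.Num => V (x 0)))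
    (h : ∀ σ ∈ T, EvalAt leafTrue T L V σ) :
    ∃ F ∈ M.Sets, IsEval leafTrue T L F ∧ ∀ σ ∈ T, pair σ 1 ∈ F ↔ V σ := by
  have := Fact.mk hT
  have {k : ℕ} {f : (Fin k → M.Num) → M.Num} [Comp f] : D1 (fun x => V (f x)) :=
    D1.comp₁ hV inferInstance
  let F : Set M.Num := {x | ∃ σ, σ ≤ x ∧ ∃ v, v ≤ x ∧
    (x = pair σ v ∧ σ ∈ T ∧ ((V σ ∧ v = 1) ∨ (¬ V σ ∧ v = 0)))}
  have hmem : ∀ σ v, pair σ v ∈ F ↔ σ ∈ T ∧ ((V σ ∧ v = 1) ∨ (¬ V σ ∧ v = 0)) := fun σ v => by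
    constructor
    · rintro ⟨σ', _, v', _, e, h⟩
      obtain ⟨rfl, rfl⟩ := pair_inj.1 e
      exact h
    · exact fun h => ⟨σ, left_le_pair _ _, v, right_le_pair _ _, rfl, h⟩
  have hone : ∀ σ ∈ T, pair σ 1 ∈ F ↔ V σ := fun σ hσ => by
    rw [hmem]
    have : ¬ (1 : M.Num) = 0 := one_ne_zero
    tauto
  refine ⟨F, D1.setOf_mem inferInstance, ⟨⟨?_, fun σ hσ => ?_⟩, fun σ hσ => ?_, fun σ hσ => ?_⟩,
    hone⟩
  · rintro _ ⟨σ, _, v, _, rfl, hσ, _⟩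
    exact ⟨σ, hσ, v, rfl⟩
  · simp only [hmem]
    by_cases hv : V σ
    · exact ⟨1, ⟨hσ, .inl ⟨hv, rfl⟩⟩, fun v h => by tauto⟩
    · exact ⟨0, ⟨hσ, .inr ⟨hv, rfl⟩⟩, fun v h => by tauto⟩
  · simp only [hmem]; tauto
  · obtain ⟨h₁, h₂, h₃⟩ := h σ hσ
    refine ⟨fun c hc => (hone σ hσ).trans (h₁ c hc), fun hl => ?_, fun hl => ?_⟩
    · rw [hone σ hσ, h₂ hl]
      exact exists_congr fun τ => and_congr_right fun hτ => (hone τ hτ.1).symm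
    · rw [hone σ hσ, h₃ hl]
      exact forall₂_congr fun τ hτ => (hone τ hτ.1).symm

/-- Two evaluation maps agree at the root: a node where they disagree has a child where they
disagree, so otherwise the tree would have a path. -/
theorem IsEval.root_iff {leafOK leafTrue : M.Num → Prop} {T L F F' : Set M.Num}
    (hT : T ∈ M.Sets) (hTL : IsLabeledTree leafOK T L) (hFs : F ∈ M.Sets) (hFs' : F' ∈ M.Sets)
    (hF : IsEval leafTrue T L F) (hF' : IsEval leafTrue T L F') :
    pair nil 1 ∈ F ↔ pair nil 1 ∈ F' := by
  by_contra hne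
  have := Fact.mk hT
  have := Fact.mk hFs
  have := Fact.mk hFs'
  have hD : {σ | σ ∈ T ∧ ¬ (pair σ 1 ∈ F ↔ pair σ 1 ∈ F')} ∈ M.Sets := D1.setOf_mem inferInstance
  obtain ⟨G, hG, hpath⟩ := exists_path hD ⟨hTL.1.1, hne⟩ fun σ ⟨hσ, hσne⟩ => by
    obtain ⟨h₁, h₂, h₃⟩ := hF.2.2 σ hσ
    obtain ⟨h₁', h₂', h₃'⟩ := hF'.2.2 σ hσ
    by_contra hno
    have hag : ∀ τ, Child T σ τ → (pair τ 1 ∈ F ↔ pair τ 1 ∈ F') := fun τ hτ => by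
      by_contra h
      exact hno ⟨τ, ⟨hτ.1, h⟩, hτ.2⟩
    apply hσne
    by_cases hch : ∃ τ, Child T σ τ
    · rcases (hTL.2.2.2 σ hσ).1 hch with hl | hl
      · rw [h₂ hl, h₂' hl]
        exact exists_congr fun τ => and_congr_right (hag τ)
      · rw [h₃ hl, h₃' hl]
        exact forall₂_congr hag
    · obtain ⟨c, -, hc⟩ := (hTL.2.2.2 σ hσ).2 hch
      rw [h₁ c hc, h₁' c hc]
  refine hTL.2.1 G hG ⟨hpath.1, fun n => ?_⟩
  obtain ⟨σ, hσ, h⟩ := hpath.2 n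
  exact ⟨σ, hσ.1, h⟩

theorem isTrueFormula_iff {T L F : Set M.Num} (hT : T ∈ M.Sets) (hTL : IsFormula T L)
    (hFs : F ∈ M.Sets) (hF : IsFormulaEval T L F) : IsTrueFormula T L ↔ pair nil 1 ∈ F :=
  ⟨fun ⟨_, hFs', hF', h⟩ => (IsEval.root_iff hT hTL hFs hFs' hF hF').2 h, fun h => ⟨F, hFs, hF, h⟩⟩

/-! ### The union of a sequence of labeled trees -/

theorem Prepend.mem_unionTree {TT : Set M.Num} {k σ τ : M.Num} (h : Prepend k σ τ) :
    τ ∈ unionTree TT ↔ σ ∈ sec TT k := by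
  constructor
  · rintro (h' | ⟨k', σ', h₁, h₂⟩)
    · exact absurd h' h.ne_nil
    · obtain ⟨rfl, rfl⟩ := h.inj h₂
      exact h₁
  · exact fun h' => .inr ⟨k, σ, h', h⟩

theorem Prepend.mem_unionLabel {LL : Set M.Num} {k σ τ c : M.Num} (h : Prepend k σ τ) :
    pair τ c ∈ unionLabel LL ↔ pair σ c ∈ sec LL k := by
  constructor
  · rintro (h' | ⟨k', σ', τ', c', h₁, h₂, e⟩)
    · exact absurd (pair_inj.1 h').1 h.ne_nil
    · obtain ⟨rfl, rfl⟩ := pair_inj.1 e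
      obtain ⟨rfl, rfl⟩ := h.inj h₂
      exact h₁
  · exact fun h' => .inr ⟨k, σ, τ, c, h', h, rfl⟩

theorem nil_mem_unionLabel {LL : Set M.Num} {c : M.Num} :
    pair nil c ∈ unionLabel LL ↔ c = 0 := by
  constructor
  · rintro (h | ⟨k, σ, τ, c', -, h, e⟩)
    · exact (pair_inj.1 h).2
    · exact absurd (pair_inj.1 e).1.symm h.ne_nil
  · rintro rfl; exact .inl rfl

theorem unionTree_mem {TT : Set M.Num} (hTT : TT ∈ M.Sets) : unionTree TT ∈ M.Sets := by
  have := Fact.mk hTT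
  exact D1.setOf_mem (P := fun τ => τ = nil ∨ ∃ k σ, σ ∈ sec TT k ∧ Prepend k σ τ) inferInstance

theorem unionLabel_mem {LL : Set M.Num} (hLL : LL ∈ M.Sets) : unionLabel LL ∈ M.Sets := by
  have := Fact.mk hLL
  convert D1.setOf_mem (P := fun x => x = pair nil 0 ∨ ∃ τ, τ ≤ x ∧ ∃ c, c ≤ x ∧
    (x = pair τ c ∧ ∃ k σ, pair σ c ∈ sec LL k ∧ Prepend k σ τ)) inferInstance using 1
  ext x
  refine or_congr Iff.rfl ⟨?_, ?_⟩
  · rintro ⟨k, σ, τ, c, h₁, h₂, rfl⟩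
    exact ⟨τ, left_le_pair _ _, c, right_le_pair _ _, rfl, k, σ, h₁, h₂⟩
  · rintro ⟨τ, _, c, _, rfl, k, σ, h₁, h₂⟩
    exact ⟨k, σ, τ, c, h₁, h₂, rfl⟩

section union

variable {leafOK : M.Num → Prop} {TT LL : Set M.Num}

theorem Prepend.child_iff {k σ τ ρ : M.Num} (h : Prepend k σ τ) :
    Child (unionTree TT) τ ρ ↔ ∃ σ', Prepend k σ' ρ ∧ Child (sec TT k) σ σ' := by
  constructor
  · rintro ⟨hρ | ⟨k', σ', hσ', h'⟩, n, hn⟩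
    · obtain ⟨l, hl⟩ := h.isSeq'
      have := (hl.append_iff.1 hn).1
      rw [hρ] at this
      exact absurd (this.unique seqLen_nil) (hM.out.succ_ne_zero l)
    · obtain rfl := h.of_prefix h' hn.prefix
      exact ⟨σ', h', hσ', (h.exists_append_iff h').1 ⟨n, hn⟩⟩
  · rintro ⟨σ', h', hσ', hn⟩
    exact ⟨h'.mem_unionTree.2 hσ', (h.exists_append_iff h').2 hn⟩

theorem child_nil_iff {ρ : M.Num} (hT : ∀ k, IsTree (sec TT k)) :
    Child (unionTree TT) nil ρ ↔ ∃ k, Prepend k nil ρ := by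
  constructor
  · rintro ⟨hρ | ⟨k, σ, hσ, h⟩, n, hn⟩
    · have := (seqLen_nil.append_iff.1 hn).1
      rw [hρ] at this
      exact absurd (this.unique seqLen_nil) (hM.out.succ_ne_zero 0)
    · have := h.seqLen_iff.1 (seqLen_nil.append_iff.1 hn).1
      obtain rfl := seqLen_zero_iff.1 this
      exact ⟨k, h⟩
  · rintro ⟨k, h⟩
    refine ⟨h.mem_unionTree.2 (hT k).1, seqLen_nil.exists_append_iff.2
      ⟨h.seqLen_iff.2 seqLen_nil, h.isSeq'.nil_prefix⟩⟩

theorem isTree_unionTree (hT : ∀ k, IsTree (sec TT k)) : IsTree (unionTree TT) := by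
  refine ⟨.inl rfl, ?_, fun ρ τ hp hτ => ?_⟩
  · rintro τ (rfl | ⟨k, σ, -, h⟩)
    · exact ⟨0, seqLen_nil⟩
    · exact h.isSeq'
  · obtain ⟨l, _, hl, -, -, hent⟩ := hp.exists_len
    rcases IsSeq.eq_nil_or_prepend ⟨l, hl⟩ with rfl | ⟨k', σ', h'⟩
    · exact .inl rfl
    · rcases hτ with rfl | ⟨k, σ, hσ, h⟩
      · exact absurd (hent _ _ h'.entry_zero) (not_finMem_nil _)
      · obtain rfl := h'.of_prefix h hp
        exact h'.mem_unionTree.2 ((hT k').2.2 σ' σ ((h'.prefix_iff h).1 hp) hσ)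

/-- A path through the union, with its first entry `k` removed, is a path through the `k`-th tree. -/
theorem isWF_unionTree (hT : ∀ k, IsWF (sec TT k)) : IsWF (unionTree TT) := by
  rintro G hG ⟨hfun, hpath⟩
  have := Fact.mk hG
  have huniq : ∀ {i a b}, pair i a ∈ G → pair i b ∈ G → a = b := fun ha hb =>
    (hfun.2 _ trivial).unique ha hb
  obtain ⟨k, hk, -⟩ := hfun.2 0 trivial
  let G' : Set M.Num := {x | ∃ i, i ≤ x ∧ ∃ a, a ≤ x ∧ (x = pair i a ∧ pair (i + 1) a ∈ G)}
  have hG' : ∀ i a, pair i a ∈ G' ↔ pair (i + 1) a ∈ G := fun i a => by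
    constructor
    · rintro ⟨i', _, a', _, e, h⟩
      obtain ⟨rfl, rfl⟩ := pair_inj.1 e
      exact h
    · exact fun h => ⟨i, left_le_pair _ _, a, right_le_pair _ _, rfl, h⟩
  refine hT k G' (D1.setOf_mem inferInstance) ⟨⟨?_, fun i _ => ?_⟩, fun n => ?_⟩
  · rintro _ ⟨i, _, a, _, rfl, -⟩
    exact ⟨i, trivial, a, rfl⟩
  · simp only [hG']; exact hfun.2 (i + 1) trivial
  · obtain ⟨τ, hτ, hlen, h⟩ := hpath (n + 1)
    rcases hτ with rfl | ⟨k', σ, hσ, hpre⟩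
    · exact absurd (hlen.unique seqLen_nil) (hM.out.succ_ne_zero n)
    · obtain rfl := huniq hk (h 0 (num_pos_iff_succ.2 ⟨n, rfl⟩) k' hpre.entry_zero)
      refine ⟨σ, hσ, hpre.seqLen_iff.1 hlen, fun i hi a ha => (hG' i a).2 ?_⟩
      exact h (i + 1) (by gcongr) a (hpre.entry_succ.2 ha)

theorem isLabeledTree_union (h : ∀ k, IsLabeledTree leafOK (sec TT k) (sec LL k)) :
    IsLabeledTree leafOK (unionTree TT) (unionLabel LL) := by
  refine ⟨isTree_unionTree fun k => (h k).1, isWF_unionTree fun k => (h k).2.1, ⟨?_, ?_⟩, ?_⟩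
  · rintro x (rfl | ⟨k, σ, τ, c, h₁, h₂, rfl⟩)
    · exact ⟨nil, .inl rfl, 0, rfl⟩
    · obtain ⟨σ', hσ', a, e⟩ := (h k).2.2.1.1 _ h₁
      obtain ⟨rfl, rfl⟩ := pair_inj.1 e
      exact ⟨τ, h₂.mem_unionTree.2 hσ', c, rfl⟩
  · rintro τ (rfl | ⟨k, σ, hσ, hpre⟩)
    · simp only [nil_mem_unionLabel, existsUnique_eq]
    · simp only [hpre.mem_unionLabel]
      exact (h k).2.2.1.2 σ hσ
  · rintro τ (rfl | ⟨k, σ, hσ, hpre⟩)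
    · refine ⟨fun _ => .inl (.inl rfl), fun hno => absurd ?_ hno⟩
      obtain ⟨τ, hτ⟩ := exists_prepend (0 : M.Num) ⟨0, seqLen_nil⟩
      exact ⟨τ, (child_nil_iff fun k => (h k).1).2 ⟨0, hτ⟩⟩
    · have hch : (∃ ρ, Child (unionTree TT) τ ρ) ↔ ∃ σ', Child (sec TT k) σ σ' := by
        simp only [hpre.child_iff]
        refine ⟨fun ⟨_, σ', _, h⟩ => ⟨σ', h⟩, fun ⟨σ', h'⟩ => ?_⟩
        obtain ⟨ρ, hρ⟩ := exists_prepend k ((h k).1.2.1 σ' h'.1)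
        exact ⟨ρ, σ', hρ, h'⟩
      simp only [hpre.mem_unionLabel, hch]
      exact (h k).2.2.2 σ hσ

/-- At the node `⟨k⟩⌢σ` of the union, the condition on an evaluation map is the one at the node `σ`
of the `k`-th tree. -/
theorem Prepend.evalAt_iff {leafTrue : M.Num → Prop} {V W : M.Num → Prop} {k σ τ : M.Num}
    (hT : IsTree (sec TT k)) (hσ : σ ∈ sec TT k) (h : Prepend k σ τ)
    (hVW : ∀ σ ∈ sec TT k, ∀ τ, Prepend k σ τ → (V τ ↔ W σ)) :
    EvalAt leafTrue (unionTree TT) (unionLabel LL) V τ ↔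
      EvalAt leafTrue (sec TT k) (sec LL k) W σ := by
  have h₁ : (∃ ρ, Child (unionTree TT) τ ρ ∧ V ρ) ↔ ∃ σ', Child (sec TT k) σ σ' ∧ W σ' := by
    simp only [h.child_iff]
    constructor
    · rintro ⟨ρ, ⟨σ', hρ, h'⟩, hv⟩
      exact ⟨σ', h', (hVW σ' h'.1 ρ hρ).1 hv⟩
    · rintro ⟨σ', h', hw⟩
      obtain ⟨ρ, hρ⟩ := exists_prepend k (hT.2.1 σ' h'.1)
      exact ⟨ρ, ⟨σ', hρ, h'⟩, (hVW σ' h'.1 ρ hρ).2 hw⟩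
  have h₂ : (∀ ρ, Child (unionTree TT) τ ρ → V ρ) ↔ ∀ σ', Child (sec TT k) σ σ' → W σ' := by
    simp only [h.child_iff]
    constructor
    · intro H σ' h'
      obtain ⟨ρ, hρ⟩ := exists_prepend k (hT.2.1 σ' h'.1)
      exact (hVW σ' h'.1 ρ hρ).1 (H ρ ⟨σ', hρ, h'⟩)
    · rintro H ρ ⟨σ', hρ, h'⟩
      exact (hVW σ' h'.1 ρ hρ).2 (H σ' h')
  simp only [EvalAt, h.mem_unionLabel, hVW σ hσ τ h, h₁, h₂]

end union

/-! ### Labels -/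

omit hM in
theorem IsFunOn.eq {F D : Set M.Num} (hF : IsFunOn F D) {i a b : M.Num} (hi : i ∈ D)
    (ha : pair i a ∈ F) (hb : pair i b ∈ F) : a = b :=
  (hF.2 i hi).unique ha hb

theorem IsFunOn.mem {F D : Set M.Num} (hF : IsFunOn F D) {i a : M.Num} (ha : pair i a ∈ F) :
    i ∈ D := by
  obtain ⟨j, hj, b, e⟩ := hF.1 _ ha
  rwa [(pair_inj.1 e).1]

theorem succ_succ_ne_one (c : M.Num) : c + 1 + 1 ≠ 1 := fun h => by
  have : c + 1 + 1 = 0 + 1 := by rw [h, zero_add]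
  exact hM.out.succ_ne_zero c (add_right_cancel this)

theorem succ_succ_inj {a b : M.Num} : a + 1 + 1 = b + 1 + 1 ↔ a = b := by simp

omit hM in
theorem IsLabeledTree.label_cases {leafOK : M.Num → Prop} {T L : Set M.Num}
    (h : IsLabeledTree leafOK T L) {σ : M.Num} (hσ : σ ∈ T) :
    (pair σ 0 ∈ L ∨ pair σ 1 ∈ L) ∨ ∃ c, leafOK c ∧ pair σ (c + 1 + 1) ∈ L := by
  by_cases hch : ∃ τ, Child T σ τ
  · exact .inl ((h.2.2.2 σ hσ).1 hch)
  · exact .inr ((h.2.2.2 σ hσ).2 hch)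

theorem IsLabeledTree.leafOK_of_label {leafOK : M.Num → Prop} {T L : Set M.Num}
    (h : IsLabeledTree leafOK T L) {σ c : M.Num} (hc : pair σ (c + 1 + 1) ∈ L) : leafOK c := by
  have hσ := h.2.2.1.mem hc
  rcases h.label_cases hσ with (h' | h') | ⟨d, hd, h'⟩
  · exact absurd (h.2.2.1.eq hσ hc h') (hM.out.succ_ne_zero _)
  · exact absurd (h.2.2.1.eq hσ hc h') (succ_succ_ne_one c)
  · rwa [succ_succ_inj.1 (h.2.2.1.eq hσ hc h')]

/-! ### Formulas as Borel codes -/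

theorem isClopenCode_zero : IsClopenCode (0 : M.Num) :=
  ⟨fun c h => absurd h (hM.out.not_lt_zero c), fun p hp => absurd hp (not_finMem_nil p)⟩

theorem not_inClopen_zero (X : Set M.Num) : ¬ InClopen X 0 :=
  fun ⟨p, hp, _⟩ => not_finMem_nil p hp

variable (M) in
/-- The whole of `2^ω` is the clopen set given by the empty string. -/
theorem exists_clopenCode_univ :
    ∃ w : M.Num, IsClopenCode w ∧ ∀ X : Set M.Num, InClopen X w := by
  obtain ⟨w, hw, hmem⟩ := D1.exists_finCode (P := fun x : M.Num => x = nil) inferInstance 1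
  refine ⟨w, ⟨hw, fun p hp => ?_⟩, fun X => ⟨nil, (hmem nil).2 ⟨zero_lt_one, rfl⟩, fun i => ?_⟩⟩
  · rw [((hmem p).1 hp).2]
    exact ⟨⟨0, seqLen_nil⟩, fun i a h => absurd h (not_finMem_nil _)⟩
  · exact ⟨fun h => absurd h (not_finMem_nil _), fun h => absurd h (not_finMem_nil _)⟩

/-- `L'` is obtained from the labeling `L` of a formula by replacing the leaf label `true` by the
clopen code `w`; the leaf label `false` already is the code of the empty set. -/
def IsClopenRelabeling (w : M.Num) (L L' : Set M.Num) : Prop :=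
  ∀ x, x ∈ L' ↔ ∃ σ, σ ≤ x ∧ ∃ c, c ≤ x ∧ (x = pair σ c ∧
    ((pair σ c ∈ L ∧ c ≠ 1 + 1 + 1) ∨ (pair σ (1 + 1 + 1) ∈ L ∧ c = w + 1 + 1)))

theorem IsClopenRelabeling.pair_mem_iff {w σ c : M.Num} {L L' : Set M.Num}
    (h : IsClopenRelabeling w L L') : pair σ c ∈ L' ↔
      (pair σ c ∈ L ∧ c ≠ 1 + 1 + 1) ∨ (pair σ (1 + 1 + 1) ∈ L ∧ c = w + 1 + 1) := by
  rw [h]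
  constructor
  · rintro ⟨σ', _, c', _, e, h'⟩
    obtain ⟨rfl, rfl⟩ := pair_inj.1 e
    exact h'
  · exact fun h' => ⟨σ, left_le_pair _ _, c, right_le_pair _ _, rfl, h'⟩

theorem IsClopenRelabeling.isBorelCode {w : M.Num} {T L L' : Set M.Num}
    (h : IsClopenRelabeling w L L') (hw : IsClopenCode w) (hTL : IsFormula T L) :
    IsBorelCode T L' := by
  obtain ⟨hT, hwf, hfun, hlab⟩ := hTL
  refine ⟨hT, hwf, ⟨fun x hx => ?_, fun σ hσ => ?_⟩, fun σ hσ => ⟨fun hch => ?_, fun hch => ?_⟩⟩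
  · obtain ⟨σ, _, c, _, rfl, ⟨h', _⟩ | ⟨h', _⟩⟩ := (h x).1 hx <;>
      exact ⟨σ, hfun.mem h', c, rfl⟩
  · obtain ⟨c, hc, hu⟩ := hfun.2 σ hσ
    simp only [h.pair_mem_iff]
    by_cases h3 : c = 1 + 1 + 1
    · subst h3
      refine ⟨w + 1 + 1, .inr ⟨hc, rfl⟩, ?_⟩
      rintro d (⟨hd, hne⟩ | ⟨_, hd⟩)
      · exact absurd (hu d hd) hne
      · exact hd
    · refine ⟨c, .inl ⟨hc, h3⟩, ?_⟩
      rintro d (⟨hd, _⟩ | ⟨hd, _⟩)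
      · exact hu d hd
      · exact absurd (hu _ hd).symm h3
  · simp only [h.pair_mem_iff]
    rcases (hlab σ hσ).1 hch with h' | h'
    · exact .inl (.inl ⟨h', (hM.out.succ_ne_zero _).symm⟩)
    · exact .inr (.inl ⟨h', (succ_succ_ne_one _).symm⟩)
  · simp only [h.pair_mem_iff]
    obtain ⟨c, rfl | rfl, hc⟩ := (hlab σ hσ).2 hch
    · exact ⟨0, isClopenCode_zero, .inl ⟨hc, fun h => zero_ne_one (succ_succ_inj.1 h)⟩⟩
    · exact ⟨w, hw, .inr ⟨hc, rfl⟩⟩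

theorem IsClopenRelabeling.evalAt_iff {w : M.Num} {T L L' X : Set M.Num} {V : M.Num → Prop}
    {σ : M.Num} (h : IsClopenRelabeling w L L') (hw : InClopen X w) (hTL : IsFormula T L) :
    EvalAt (InClopen X) T L' V σ ↔ EvalAt (fun c => c = 1) T L V σ := by
  have h0 : pair σ 0 ∈ L' ↔ pair σ 0 ∈ L := by
    rw [h.pair_mem_iff, or_iff_left fun h => (hM.out.succ_ne_zero _).symm h.2]
    exact and_iff_left (hM.out.succ_ne_zero _).symm
  have h1 : pair σ 1 ∈ L' ↔ pair σ 1 ∈ L := by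
    rw [h.pair_mem_iff, or_iff_left fun h => (succ_succ_ne_one _).symm h.2]
    exact and_iff_left (succ_succ_ne_one _).symm
  unfold EvalAt
  rw [h0, h1]
  refine and_congr_left fun _ => ⟨fun H c hc => ?_, fun H c hc => ?_⟩
  · rcases hTL.leafOK_of_label hc with rfl | rfl
    · rw [H 0 (h.pair_mem_iff.2 (.inl ⟨hc, fun h => zero_ne_one (succ_succ_inj.1 h)⟩))]
      exact iff_of_false (not_inClopen_zero X) zero_ne_one
    · rw [H w (h.pair_mem_iff.2 (.inr ⟨hc, rfl⟩))]
      exact iff_of_true hw rfl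
  · rcases h.pair_mem_iff.1 hc with ⟨hc, hne⟩ | ⟨hc, e⟩
    · have hne' : c ≠ 1 := fun e => hne (by rw [e])
      obtain rfl := (hTL.leafOK_of_label hc).resolve_right hne'
      exact (H 0 hc).trans (iff_of_false hne' (not_inClopen_zero X))
    · obtain rfl := succ_succ_inj.1 e
      exact (H 1 hc).trans (iff_of_true rfl hw)

omit hM in
theorem IsEval.congr {p q : M.Num → Prop} {T L L' F : Set M.Num} (hF : IsEval p T L F)
    (h : ∀ σ ∈ T, EvalAt p T L (fun τ => pair τ 1 ∈ F) σ →
      EvalAt q T L' (fun τ => pair τ 1 ∈ F) σ) :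
    IsEval q T L' F :=
  ⟨hF.1, hF.2.1, fun σ hσ => h σ hσ (hF.evalAt hσ)⟩

/-- An evaluation map of the union of the formulas, read as Borel codes, shows which formulas
are true. -/
theorem CountableUnionCD.lomegaCA (hU : M.CountableUnionCD) : M.LomegaCA := by
  intro TT hTT LL hLL hφ
  have := Fact.mk hTT
  have := Fact.mk hLL
  obtain ⟨w, hw, hwX⟩ := exists_clopenCode_univ M
  obtain ⟨LL', hLL', hmem⟩ := D1.exists_seq (P := fun k x => ∃ σ, σ ≤ x ∧ ∃ c, c ≤ x ∧
    (x = pair σ c ∧ ((pair σ c ∈ sec LL k ∧ c ≠ 1 + 1 + 1) ∨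
      (pair σ (1 + 1 + 1) ∈ sec LL k ∧ c = w + 1 + 1)))) (by infer_instance)
  have hrel : ∀ k, IsClopenRelabeling w (sec LL k) (sec LL' k) := fun k x => hmem k x
  have hcd : ∀ k, IsCDBorelCode (sec TT k) (sec LL' k) := fun k => by
    obtain ⟨hf, F, hFs, hF⟩ := hφ k
    exact ⟨(hrel k).isBorelCode hw hf, fun X _ =>
      ⟨F, hFs, hF.congr fun σ _ => ((hrel k).evalAt_iff (hwX X) hf).2⟩⟩
  obtain ⟨-, -, -, hev⟩ := hU TT hTT LL' hLL' hcd
  obtain ⟨X, hX⟩ := M.sets_nonempty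
  obtain ⟨F, hFs, hF⟩ := hev X hX
  have := Fact.mk hFs
  refine ⟨_, D1.setOf_mem (P := fun k => ∃ τ, Prepend k nil τ ∧ pair τ 1 ∈ F) inferInstance,
    fun k => ?_⟩
  obtain ⟨hf, -⟩ := hφ k
  obtain ⟨Fk, hFks, hFk, hval⟩ := D1.exists_isEval (leafTrue := fun c => c = 1) (L := sec LL k)
    (sec_mem hTT k) (V := fun σ => ∃ τ, Prepend k σ τ ∧ pair τ 1 ∈ F) inferInstance
    fun σ hσ => by
      obtain ⟨τ, hτ⟩ := exists_prepend k (hf.1.2.1 σ hσ)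
      rw [← (hrel k).evalAt_iff (hwX X) hf]
      refine (hτ.evalAt_iff (V := fun τ => pair τ 1 ∈ F) hf.1 hσ fun σ' _ τ' hτ' =>
        ⟨fun h => ⟨τ', hτ', h⟩, fun ⟨_, h', h⟩ => ?_⟩).1 (hF.evalAt (hτ.mem_unionTree.2 hσ))
      rwa [hτ'.unique h']
  rw [isTrueFormula_iff (sec_mem hTT k) hf hFks hFk, hval nil hf.1.1]
  rfl

/-! ### The formula expressing that a point belongs to the set coded at a node -/

theorem inClopen_iff_bdd {X : Set M.Num} {c : M.Num} : InClopen X c ↔ ∃ p, p < c ∧ (FinMem p c ∧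
    ∀ i, i < p → (Entry p i 1 → i ∈ X) ∧ (Entry p i 0 → i ∉ X)) := by
  constructor
  · rintro ⟨p, hp, h⟩
    exact ⟨p, hp.lt, hp, fun i _ => h i⟩
  · rintro ⟨p, _, hp, h⟩
    exact ⟨p, hp, fun i => ⟨fun hi => (h i hi.index_lt).1 hi, fun hi => (h i hi.index_lt).2 hi⟩⟩

instance D1.inClopen {k : ℕ} {f : (Fin k → M.Num) → M.Num} {X : Set M.Num} [Fact (X ∈ M.Sets)]
    [Comp f] : D1 (fun x => InClopen X (f x)) :=
  D1.comp₁ (R := fun c => InClopen X c) (by simp only [inClopen_iff_bdd]; infer_instance)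
    inferInstance

/-- `c` is the label of the node `τ` in the formula of `IsNodeFormula`; the labels `1 + 1 + 1` and
`0 + 1 + 1` stand for the atomic formulas `true` and `false`. -/
def NodeLabel (X T L : Set M.Num) (σ τ c : M.Num) : Prop :=
  τ ∈ T ∧ ((Prefix τ σ ∧ τ ≠ σ ∧ c = 0) ∨ (Prefix σ τ ∧ ((pair τ c ∈ L ∧ (c = 0 ∨ c = 1)) ∨
    ∃ d, pair τ (d + 1 + 1) ∈ L ∧ ((InClopen X d ∧ c = 1 + 1 + 1) ∨
      (¬ InClopen X d ∧ c = 0 + 1 + 1)))))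

/-- `(T', L')` is the formula saying that `X` belongs to the set coded at the node `σ` of `(T, L)`.
It consists of the nodes comparable with `σ`: those properly below `σ` are labeled `∪` and have
only one child, so that they have the value of `σ`; from `σ` on, the tree is that of `T`, and the
clopen sets at its leaves are replaced by truth values. In this way no subtree has to be
re-rooted. -/
structure IsNodeFormula (X T L : Set M.Num) (σ : M.Num) (T' L' : Set M.Num) : Prop where
  mem_tree : ∀ τ, τ ∈ T' ↔ τ ∈ T ∧ (Prefix τ σ ∨ Prefix σ τ)
  mem_label : ∀ τ c, pair τ c ∈ L' ↔ NodeLabel X T L σ τ c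
  isPair : ∀ x ∈ L', ∃ τ c, x = pair τ c

namespace IsNodeFormula

variable {X T L T' L' : Set M.Num} {σ τ ρ : M.Num}

theorem child_iff_of_prefix (h : IsNodeFormula X T L σ T' L') (hp : Prefix σ τ) :
    Child T' τ ρ ↔ Child T τ ρ := by
  refine ⟨fun ⟨h₁, h₂⟩ => ⟨((h.mem_tree ρ).1 h₁).1, h₂⟩, fun ⟨h₁, n, hn⟩ => ⟨?_, n, hn⟩⟩
  exact (h.mem_tree ρ).2 ⟨h₁, .inr (hp.trans hn.prefix)⟩

theorem prefix_of_child (h : IsNodeFormula X T L σ T' L') (hp : Prefix τ σ) (hne : τ ≠ σ)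
    (hρ : Child T' τ ρ) : Prefix ρ σ := by
  obtain ⟨hρ, n, hn⟩ := hρ
  rcases ((h.mem_tree ρ).1 hρ).2 with h' | h'
  · exact h'
  -- The length of `ρ` exceeds that of `τ` by one only, so `ρ` cannot be a proper extension of `σ`.
  · obtain ⟨l, m, hτ, hσ, hle, -⟩ := hp.exists_len
    have hlt : l < m := lt_of_not_ge fun h => hne (hp.eq_of_len_le hτ hσ h)
    have hρl := (hτ.append_iff.1 hn).1
    obtain rfl := h'.eq_of_len_le hσ hρl (num_succ_le_iff.2 hlt)
    exact h'

theorem exists_child (h : IsNodeFormula X T L σ T' L') (hT : IsTree T) (hσ : σ ∈ T)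
    (hp : Prefix τ σ) (hne : τ ≠ σ) : ∃ ρ, Child T' τ ρ := by
  obtain ⟨l, m, hτl, hσl, hle, -⟩ := hp.exists_len
  have hlt : l < m := lt_of_not_ge fun h => hne (hp.eq_of_len_le hτl hσl h)
  obtain ⟨ρ, hρl, hρ⟩ := hσl.exists_restrict (num_succ_le_iff.2 hlt)
  exact ⟨ρ, (h.mem_tree ρ).2 ⟨hT.2.2 _ _ hρ hσ, .inl hρ⟩, hτl.exists_append_iff.2
    ⟨hρl, hp.prefix_of_len_le hρ hτl hρl le_self_add⟩⟩

theorem mem_label_below (h : IsNodeFormula X T L σ T' L') (hτ : τ ∈ T) (hp : Prefix τ σ)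
    (hne : τ ≠ σ) {c : M.Num} : pair τ c ∈ L' ↔ c = 0 := by
  rw [h.mem_label, NodeLabel]
  have : ¬ Prefix σ τ := fun h' => hne (hp.antisymm h')
  tauto

theorem mem_label_above (h : IsNodeFormula X T L σ T' L') (hτ : τ ∈ T) (hp : Prefix σ τ)
    {c : M.Num} : pair τ c ∈ L' ↔ (pair τ c ∈ L ∧ (c = 0 ∨ c = 1)) ∨
      ∃ d, pair τ (d + 1 + 1) ∈ L ∧ ((InClopen X d ∧ c = 1 + 1 + 1) ∨
        (¬ InClopen X d ∧ c = 0 + 1 + 1)) := by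
  rw [h.mem_label, NodeLabel]
  rw [and_iff_right hτ, and_iff_right hp]
  exact or_iff_right fun h' => h'.2.1 (h'.1.antisymm hp)

theorem mem_cases (h : IsNodeFormula X T L σ T' L') (hτ : τ ∈ T') :
    τ ∈ T ∧ ((Prefix τ σ ∧ τ ≠ σ) ∨ Prefix σ τ) := by
  obtain ⟨h₁, h₂⟩ := (h.mem_tree τ).1 hτ
  refine ⟨h₁, ?_⟩
  rcases h₂ with h₂ | h₂
  · by_cases e : τ = σ
    · subst e; exact .inr h₂
    · exact .inl ⟨h₂, e⟩
  · exact .inr h₂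

theorem isFormula (h : IsNodeFormula X T L σ T' L') (hTL : IsBorelCode T L) (hσ : σ ∈ T) :
    IsFormula T' L' := by
  obtain ⟨hT, hwf, hfun, hlab⟩ := id hTL
  refine ⟨⟨(h.mem_tree _).2 ⟨hT.1, .inl (hT.2.1 σ hσ).nil_prefix⟩, fun τ hτ =>
    hT.2.1 τ ((h.mem_tree τ).1 hτ).1, fun ρ τ hρτ hτ => ?_⟩, fun G hG hpath => ?_,
    ⟨fun x hx => ?_, fun τ hτ => ?_⟩, fun τ hτ => ?_⟩
  · obtain ⟨hτ, hc⟩ := (h.mem_tree τ).1 hτ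
    refine (h.mem_tree ρ).2 ⟨hT.2.2 _ _ hρτ hτ, ?_⟩
    rcases hc with hc | hc
    · exact .inl (hρτ.trans hc)
    · obtain ⟨l, hl⟩ := hT.2.1 ρ (hT.2.2 _ _ hρτ hτ)
      obtain ⟨m, hm⟩ := hT.2.1 σ hσ
      rcases le_total l m with hlm | hlm
      · exact .inl (hρτ.prefix_of_len_le hc hl hm hlm)
      · exact .inr (hc.prefix_of_len_le hρτ hm hl hlm)
  · refine hwf G hG ⟨hpath.1, fun n => ?_⟩
    obtain ⟨τ, hτ, h'⟩ := hpath.2 n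
    exact ⟨τ, ((h.mem_tree τ).1 hτ).1, h'⟩
  · obtain ⟨τ, c, rfl⟩ := h.isPair x hx
    obtain ⟨hτ, h'⟩ := (h.mem_label τ c).1 hx
    exact ⟨τ, (h.mem_tree τ).2 ⟨hτ, h'.imp (·.1) (·.1)⟩, c, rfl⟩
  · obtain ⟨hτT, ⟨hp, hne⟩ | hp⟩ := h.mem_cases hτ
    · simp only [h.mem_label_below hτT hp hne, existsUnique_eq]
    · have huniq : ∀ {a b}, pair τ a ∈ L → pair τ b ∈ L → a = b := hfun.eq hτT
      simp only [h.mem_label_above hτT hp]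
      rcases hTL.label_cases hτT with hl | ⟨d, -, hd⟩
      · obtain ⟨c, hc, hcl⟩ : ∃ c, (c = 0 ∨ c = 1) ∧ pair τ c ∈ L :=
          hl.elim (fun h => ⟨0, .inl rfl, h⟩) fun h => ⟨1, .inr rfl, h⟩
        refine ⟨c, .inl ⟨hcl, hc⟩, ?_⟩
        rintro b (⟨hb, _⟩ | ⟨d, hd, _⟩)
        · exact huniq hb hcl
        · rcases hc with rfl | rfl
          · exact absurd (huniq hd hcl) (hM.out.succ_ne_zero _)
          · exact absurd (huniq hd hcl) (succ_succ_ne_one d)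
      · have hne : ∀ {c}, pair τ c ∈ L → ¬ (c = 0 ∨ c = 1) := by
          rintro c hc (rfl | rfl)
          · exact hM.out.succ_ne_zero _ (huniq hd hc)
          · exact succ_succ_ne_one d (huniq hd hc)
        by_cases hX : InClopen X d
        · refine ⟨1 + 1 + 1, .inr ⟨d, hd, .inl ⟨hX, rfl⟩⟩, ?_⟩
          rintro b (⟨hb, hb'⟩ | ⟨d', hd', hb⟩)
          · exact absurd hb' (hne hb)
          · obtain rfl := succ_succ_inj.1 (huniq hd hd'); tauto
        · refine ⟨0 + 1 + 1, .inr ⟨d, hd, .inr ⟨hX, rfl⟩⟩, ?_⟩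
          rintro b (⟨hb, hb'⟩ | ⟨d', hd', hb⟩)
          · exact absurd hb' (hne hb)
          · obtain rfl := succ_succ_inj.1 (huniq hd hd'); tauto
  · obtain ⟨hτT, ⟨hp, hne⟩ | hp⟩ := h.mem_cases hτ
    · simp only [h.mem_label_below hτT hp hne, true_or]
      exact ⟨fun _ => trivial, fun hno => absurd (h.exists_child hT hσ hp hne) hno⟩
    · simp only [h.child_iff_of_prefix hp, h.mem_label_above hτT hp]
      refine ⟨fun hch => ?_, fun hch => ?_⟩
      · exact ((hlab τ hτT).1 hch).imp (fun h => .inl ⟨h, by simp⟩) fun h => .inl ⟨h, by simp⟩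
      · obtain ⟨d, -, hd⟩ := (hlab τ hτT).2 hch
        by_cases hX : InClopen X d
        · exact ⟨1, .inr rfl, .inr ⟨d, hd, .inl ⟨hX, rfl⟩⟩⟩
        · exact ⟨0, .inl rfl, .inr ⟨d, hd, .inr ⟨hX, rfl⟩⟩⟩

/-- An evaluation map for `X` in `(T, L)` induces one for the formula at the node `σ`, and the
root of the formula gets the value of `σ`. -/
theorem exists_eval {F : Set M.Num} (h : IsNodeFormula X T L σ T' L') (hTL : IsBorelCode T L)
    (hσ : σ ∈ T) (hT' : T' ∈ M.Sets) (hFs : F ∈ M.Sets) (hF : IsEval (InClopen X) T L F) :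
    ∃ F' ∈ M.Sets, IsFormulaEval T' L' F' ∧ (pair nil 1 ∈ F' ↔ pair σ 1 ∈ F) := by
  have := Fact.mk hFs
  have hT := hTL.1
  let V : M.Num → Prop := fun τ => (Prefix σ τ ∧ pair τ 1 ∈ F) ∨ (¬ Prefix σ τ ∧ pair σ 1 ∈ F)
  have hbelow : ∀ τ, Prefix τ σ → (V τ ↔ pair σ 1 ∈ F) := fun τ hp => by
    by_cases h' : Prefix σ τ
    · obtain rfl := hp.antisymm h'
      simp only [V]; tauto
    · simp only [V]; tauto
  have habove : ∀ τ, Prefix σ τ → (V τ ↔ pair τ 1 ∈ F) := fun τ hp => by simp only [V]; tauto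
  obtain ⟨F', hFs', hF', hval⟩ := D1.exists_isEval (leafTrue := fun c => c = 1) (L := L') hT'
    (V := V) inferInstance fun τ hτ => by
      obtain ⟨hτT, ⟨hp, hne⟩ | hp⟩ := h.mem_cases hτ
      · simp only [EvalAt, h.mem_label_below hτT hp hne, hbelow τ hp]
        refine ⟨fun c hc => absurd hc (hM.out.succ_ne_zero _), fun _ => ?_,
          fun hc => absurd hc one_ne_zero⟩
        constructor
        · intro hv
          obtain ⟨ρ, hρ⟩ := h.exists_child hT hσ hp hne
          exact ⟨ρ, hρ, (hbelow ρ (h.prefix_of_child hp hne hρ)).2 hv⟩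
        · rintro ⟨ρ, hρ, hv⟩
          exact (hbelow ρ (h.prefix_of_child hp hne hρ)).1 hv
      · obtain ⟨h₁, h₂, h₃⟩ := hF.2.2 τ hτT
        have hV : ∀ ρ, Child T τ ρ → (V ρ ↔ pair ρ 1 ∈ F) := fun ρ ⟨_, n, hn⟩ =>
          habove ρ (hp.trans hn.prefix)
        simp only [EvalAt, h.mem_label_above hτT hp, habove τ hp, h.child_iff_of_prefix hp]
        refine ⟨fun c hc => ?_, fun hc => ?_, fun hc => ?_⟩
        · rcases hc with ⟨_, hc | hc⟩ | ⟨d, hd, ⟨hX, hc⟩ | ⟨hX, hc⟩⟩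
          · exact absurd hc (hM.out.succ_ne_zero _)
          · exact absurd hc (succ_succ_ne_one c)
          · exact (h₁ d hd).trans (iff_of_true hX (succ_succ_inj.1 hc))
          · refine (h₁ d hd).trans (iff_of_false hX ?_)
            rw [succ_succ_inj.1 hc]; exact zero_ne_one
        · rcases hc with ⟨hc, -⟩ | ⟨d, -, ⟨-, hc⟩ | ⟨-, hc⟩⟩
          · rw [h₂ hc]; exact exists_congr fun ρ => and_congr_right fun hρ => (hV ρ hρ).symm
          · exact absurd hc.symm (hM.out.succ_ne_zero _)
          · exact absurd hc.symm (hM.out.succ_ne_zero _)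
        · rcases hc with ⟨hc, -⟩ | ⟨d, -, ⟨-, hc⟩ | ⟨-, hc⟩⟩
          · rw [h₃ hc]; exact forall₂_congr fun ρ hρ => (hV ρ hρ).symm
          · exact absurd hc.symm (succ_succ_ne_one _)
          · exact absurd hc.symm (succ_succ_ne_one _)
  have hnil := (hT.2.1 σ hσ).nil_prefix
  exact ⟨F', hFs', hF', (hval nil ((h.mem_tree _).2 ⟨hT.1, .inl hnil⟩)).trans (hbelow _ hnil)⟩

end IsNodeFormula

set_option synthInstance.maxSize 1000 in
/-- The formulas at all nodes of a sequence of Borel codes form one sequence, in which the formula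
at the node `σ` of the `k`-th code has the index `(k, σ)`. Each of the other indices gets one of
these formulas as well. -/
theorem exists_nodeFormulas {X TT LL : Set M.Num} (hX : X ∈ M.Sets) (hTT : TT ∈ M.Sets)
    (hLL : LL ∈ M.Sets) (h : ∀ k, IsBorelCode (sec TT k) (sec LL k)) :
    ∃ TT' ∈ M.Sets, ∃ LL' ∈ M.Sets,
      (∀ e, ∃ k, ∃ σ ∈ sec TT k,
        IsNodeFormula X (sec TT k) (sec LL k) σ (sec TT' e) (sec LL' e)) ∧
      ∀ k, ∀ σ ∈ sec TT k, IsNodeFormula X (sec TT k) (sec LL k) σ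
        (sec TT' (pair k σ)) (sec LL' (pair k σ)) := by
  have := Fact.mk hX
  have := Fact.mk hTT
  have := Fact.mk hLL
  -- `g` is the identity on the indices of nodes and sends any other number to such an index.
  obtain ⟨g, hg, hgR⟩ := D1.exists_comp (R := fun e p : M.Num => ∃ k, k ≤ p ∧ ∃ σ, σ ≤ p ∧
    ((p = pair k σ ∧ σ ∈ sec TT k) ∧ ∀ k', k' ≤ e → ∀ σ', σ' ≤ e →
      (e = pair k' σ' ∧ σ' ∈ sec TT k' → p = e))) inferInstance fun e => by
      by_cases he : ∃ k σ, e = pair k σ ∧ σ ∈ sec TT k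
      · obtain ⟨k, σ, rfl, hσ⟩ := he
        exact ⟨_, k, left_le_pair _ _, σ, right_le_pair _ _, ⟨rfl, hσ⟩, fun _ _ _ _ _ => rfl⟩
      · exact ⟨pair 0 nil, 0, left_le_pair _ _, nil, right_le_pair _ _, ⟨rfl, (h 0).1.1⟩,
          fun k' _ σ' _ h' => absurd ⟨k', σ', h'⟩ he⟩
  have {k : ℕ} {f : (Fin k → M.Num) → M.Num} [Comp f] : Comp (fun x => g (f x)) :=
    Comp.comp₁ hg inferInstance
  -- The labels of the nodes as a function, which bounds the codes of the clopen sets.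
  obtain ⟨lab, hlab, hlabR⟩ := D1.exists_comp (R := fun p c : M.Num => ∀ k, k ≤ p → ∀ τ, τ ≤ p →
    (p = pair k τ ∧ τ ∈ sec TT k → pair τ c ∈ sec LL k)) inferInstance fun p => by
      by_cases hp : ∃ k τ, p = pair k τ ∧ τ ∈ sec TT k
      · obtain ⟨k, τ, rfl, hτ⟩ := hp
        obtain ⟨c, hc⟩ := ((h k).2.2.1.2 τ hτ).exists
        refine ⟨c, fun k' _ τ' _ h' => ?_⟩
        obtain ⟨rfl, rfl⟩ := pair_inj.1 h'.1
        exact hc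
      · exact ⟨0, fun k _ τ _ h' => absurd ⟨k, τ, h'⟩ hp⟩
  have {k : ℕ} {f : (Fin k → M.Num) → M.Num} [Comp f] : Comp (fun x => lab (f x)) :=
    Comp.comp₁ hlab inferInstance
  obtain ⟨TT', hTT', hT'⟩ := D1.exists_seq (P := fun e τ => ∃ k, k ≤ g e ∧ ∃ σ, σ ≤ g e ∧
    (g e = pair k σ ∧ τ ∈ sec TT k ∧ (Prefix τ σ ∨ Prefix σ τ))) inferInstance
  obtain ⟨LL', hLL', hL'⟩ := D1.exists_seq (P := fun e x => ∃ k, k ≤ g e ∧ ∃ σ, σ ≤ g e ∧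
    (g e = pair k σ ∧ ∃ τ, τ ≤ x ∧ ∃ c, c ≤ x ∧ (x = pair τ c ∧ τ ∈ sec TT k ∧
      ((Prefix τ σ ∧ τ ≠ σ ∧ c = 0) ∨ (Prefix σ τ ∧ ((pair τ c ∈ sec LL k ∧ (c = 0 ∨ c = 1)) ∨
        ∃ d, d ≤ lab (pair k τ) ∧ (pair τ (d + 1 + 1) ∈ sec LL k ∧
          ((InClopen X d ∧ c = 1 + 1 + 1) ∨ (¬ InClopen X d ∧ c = 0 + 1 + 1)))))))))
    (by infer_instance)
  have key : ∀ e k σ, g e = pair k σ →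
      IsNodeFormula X (sec TT k) (sec LL k) σ (sec TT' e) (sec LL' e) := by
    intro e k σ he
    refine ⟨fun τ => ?_, fun τ c => ?_, fun x hx => ?_⟩
    · rw [hT']
      constructor
      · rintro ⟨k', _, σ', _, e', hτ⟩
        obtain ⟨rfl, rfl⟩ := pair_inj.1 (he.symm.trans e')
        exact hτ
      · exact fun hτ => ⟨k, he ▸ left_le_pair _ _, σ, he ▸ right_le_pair _ _, he, hτ⟩
    · rw [hL']
      constructor
      · rintro ⟨k', _, σ', _, e', τ', _, c', _, e'', hτ, hc⟩
        obtain ⟨rfl, rfl⟩ := pair_inj.1 (he.symm.trans e')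
        obtain ⟨rfl, rfl⟩ := pair_inj.1 e''
        exact ⟨hτ, hc.imp_right <| And.imp_right <| Or.imp_right fun ⟨d, _, hd⟩ => ⟨d, hd⟩⟩
      · rintro ⟨hτ, hc⟩
        refine ⟨k, he ▸ left_le_pair _ _, σ, he ▸ right_le_pair _ _, he, τ, left_le_pair _ _, c,
          right_le_pair _ _, rfl, hτ, hc.imp_right <| And.imp_right <| Or.imp_right
          fun ⟨d, hd⟩ => ⟨d, ?_, hd⟩⟩
        have := hlabR (pair k τ) k (left_le_pair _ _) τ (right_le_pair _ _) ⟨rfl, hτ⟩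
        rw [(h k).2.2.1.eq hτ this hd.1, add_assoc]
        exact le_self_add
    · obtain ⟨_, _, _, _, _, τ, _, c, _, rfl, _⟩ := (hL' e x).1 hx
      exact ⟨τ, c, rfl⟩
  refine ⟨TT', hTT', LL', hLL', fun e => ?_, fun k σ hσ => key _ k σ ?_⟩
  · obtain ⟨k, _, σ, _, ⟨he, hσ⟩, _⟩ := hgR e
    exact ⟨k, σ, hσ, key e k σ he⟩
  · obtain ⟨_, _, _, _, _, h'⟩ := hgR (pair k σ)
    exact h' k (left_le_pair _ _) σ (right_le_pair _ _) ⟨rfl, hσ⟩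

/-- The truth values of the formulas at all nodes form an evaluation map of the union. -/
theorem LomegaCA.countableUnionCD (hL : M.LomegaCA) : M.CountableUnionCD := by
  intro TT hTT LL hLL hcd
  refine ⟨unionTree_mem hTT, unionLabel_mem hLL, isLabeledTree_union fun k => (hcd k).1,
    fun X hX => ?_⟩
  have hT : ∀ k, IsTree (sec TT k) := fun k => (hcd k).1.1
  obtain ⟨TT', hTT', LL', hLL', hnode, hnode'⟩ :=
    exists_nodeFormulas hX hTT hLL fun k => (hcd k).1
  obtain ⟨Y, hY, hYmem⟩ := hL TT' hTT' LL' hLL' fun e => by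
    obtain ⟨k, σ, hσ, hn⟩ := hnode e
    obtain ⟨F, hFs, hF⟩ := (hcd k).2 X hX
    obtain ⟨F', hFs', hF', -⟩ := hn.exists_eval (hcd k).1 hσ (sec_mem hTT' e) hFs hF
    exact ⟨hn.isFormula (hcd k).1 hσ, F', hFs', hF'⟩
  have := Fact.mk hY
  let W : M.Num → Prop := fun τ => ∃ k σ, pair k σ ∈ Y ∧ Prepend k σ τ
  have hW : ∀ {k σ τ}, Prepend k σ τ → (W τ ↔ pair k σ ∈ Y) := fun {k σ τ} hτ =>
    ⟨fun ⟨k', σ', h, h'⟩ => by obtain ⟨rfl, rfl⟩ := hτ.inj h'; exact h, fun h => ⟨k, σ, h, hτ⟩⟩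
  have hWnil : ¬ W nil := fun ⟨k, σ, _, h⟩ => h.ne_nil rfl
  -- The value at the root is a single bit, so it may be put in without being computed.
  let b : Prop := ∃ ρ, Child (unionTree TT) nil ρ ∧ W ρ
  let V : M.Num → Prop := fun τ => (τ = nil ∧ b) ∨ W τ
  have hV : ∀ {τ}, τ ≠ nil → (V τ ↔ W τ) := fun hτ => by simp only [V]; tauto
  obtain ⟨F, hFs, hF, -⟩ := D1.exists_isEval (leafTrue := InClopen X) (L := unionLabel LL)
    (unionTree_mem hTT) (V := V) inferInstance fun τ hτ => by
      rcases hτ with rfl | ⟨k, σ, hσ, hτ⟩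
      · simp only [EvalAt, nil_mem_unionLabel]
        refine ⟨fun c hc => absurd hc (hM.out.succ_ne_zero _), fun _ => ?_,
          fun hc => absurd hc one_ne_zero⟩
        have : V nil ↔ b := by simp [V, hWnil]
        rw [this]
        refine exists_congr fun ρ => and_congr_right fun hρ => (hV ?_).symm
        obtain ⟨k, hk⟩ := (child_nil_iff hT).1 hρ
        exact hk.ne_nil
      · obtain ⟨Fk, hFks, hFk⟩ := (hcd k).2 X hX
        refine (hτ.evalAt_iff (W := fun σ => pair σ 1 ∈ Fk) (hT k) hσ fun σ hσ τ hτ => ?_).2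
          (hFk.evalAt hσ)
        have hn := hnode' k σ hσ
        obtain ⟨F', hFs', hF', hval⟩ := hn.exists_eval (hcd k).1 hσ (sec_mem hTT' _) hFks hFk
        rw [hV hτ.ne_nil, hW hτ, hYmem, ← hval]
        exact isTrueFormula_iff (sec_mem hTT' _) (hn.isFormula (hcd k).1 hσ) hFs' hF'
  exact ⟨F, hFs, hF⟩

end SOA.L2Structure

/-- `RCA₀` proves the equivalence: it holds in every model of `RCA₀`. -/
theorem mainTheorem5 (M : SOA.L2Structure.{u}) (hM : M.IsModelRCA0) :
    M.CountableUnionCD ↔ M.LomegaCA := by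
  have := Fact.mk hM
  exact ⟨fun h => h.lomegaCA, fun h => h.countableUnionCD⟩
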